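/- Let $\ell\ge 2$ and let $\theta$ be an aperiodic primitive substitution of constant length $\ell$ on a finite alphabet $\mathcal A$, with column maps $\theta_0,\dots,\theta_{\ell-1}:\mathcal A\to\mathcal A$. Write $X_\theta\subset\mathcal A^{\mathbb Z}$ for its two-sided substitution shift, $\sigma$ for the left shift, and $\mathbb Z_\ell=\varprojlim \mathbb Z/\ell^n\mathbb Z$. For $0\le k<\ell$, the *$k$-shifted extension* $\theta^{(+k)}$ is the length-$\ell$ substitution whose alphabet is the set of allowed two-letter words of $\theta$, given by $(\theta^{(+k)})_m(a_0a_1)=a'_{m+k}a'_{m+k+1}$, where $a'_0\cdots a'_{2\ell-1}=\theta(a_0a_1)$. For a substitution $\eta$ whose length is a power $\ell^n$, $n\ge1$, a *normalised factor map* is a continuous surjection $\pi:X_\eta\to\mathbb Z_\ell$ with $\pi\circ\sigma=\pi+1$ and such that $\pi(x)=0$ if and only if $x$ is $\eta$-periodic (that is, $\eta^j(x)=x$ for some $j\ge1$). Given two such substitutions $\zeta,\eta$, a shift-commuting continuous surjection $F:X_\zeta\to X_\eta$ is said to have *$\kappa$-value* $\kappa(F)=z\in\mathbb Z_\ell$ if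 normalised factor maps of $X_\zeta$ and $X_\eta$ exist and $\pi_\eta(F(x))=z+\pi_\zeta(x)$ for all $x\in X_\zeta$ and all normalised factor maps $\pi_\zeta,\pi_\eta$. 1. For every $0\le k<\ell$, with $\zeta=\theta^{(+k)}$, the code $a_0a_1\mapsto a_0$ defines a conjugacy $F:X_\zeta\to X_\theta$, and $\kappa(F)=\dfrac{k}{1-\ell}$. 2. For all integers $p$ and $q\geq 1$ with $\gcd(p,q)=1$ and $\frac pq\in\mathbb Z_\ell$ (that is, $qz=p$ for some $z\in\mathbb Z_\ell$; write $\frac pq$ for such a $z$), there are $0\le k<\ell^{\varphi(q)}$ ($\varphi$ is Euler's function) and a conjugacy $F:X_\zeta\to X_\theta$, where $\zeta=(\theta^{\varphi(q)})^{(+k)}$, with $\kappa(F)=\frac pq$. Moreover, in both parts, if $\theta$ has trivial height, i.e. if $(\mathbb Z_\ell,+1)$ is the maximal equicontinuous factor of $(X_\theta,\sigma)$, then it is also the maximal equicontinuous factor of $(X_\zeta,\sigma)$, so that the $\kappa$-values above are taken with respect to maximal equicontinuous factors. -/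

import Mathlib

universe u

/-- A length-`ℓ` substitution on the alphabet `A`: the ordered collection of its `ℓ` column maps. -/
abbrev Substitution (ℓ : ℕ) (A : Type u) : Type u := Fin ℓ → A → A

namespace Substitution

variable {ℓ : ℕ} {A : Type u}

/-- `θ(a) = θ_0(a) ⋯ θ_{ℓ-1}(a)`. -/
def onLetter (θ : Substitution ℓ A) (a : A) : List A := List.ofFn fun m => θ m a

/-- `θ(a_1 ⋯ a_k) = θ(a_1) ⋯ θ(a_k)`. -/
def onWord (θ : Substitution ℓ A) (w : List A) : List A := w.flatMap θ.onLetter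

/-- The action on bi-infinite sequences: the letter of `θ(x)` at position `ℓ i + m`,
`0 ≤ m < ℓ`, is `θ_m(x_i)`. -/
def onSeq [NeZero ℓ] (θ : Substitution ℓ A) (x : ℤ → A) : ℤ → A := fun i =>
  θ ⟨(i % (ℓ : ℤ)).toNat, by
    have h0 : (0 : ℤ) < ℓ := by exact_mod_cast Nat.pos_of_ne_zero (NeZero.ne ℓ)
    have h1 := Int.emod_nonneg i h0.ne'
    have h2 := Int.emod_lt_of_pos i h0
    omega⟩ (x (i / (ℓ : ℤ)))

/-- The `n`-th iterate `θ^n`, as a substitution of length `ℓ^n`: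
`(θ^{n+1})_{ℓ i + j} = θ_j ∘ (θ^n)_i`. -/
def power (θ : Substitution ℓ A) : (n : ℕ) → Substitution (ℓ ^ n) A
  | 0 => fun _ a => a
  | n + 1 => fun (m : Fin (ℓ ^ n * ℓ)) a => θ m.modNat (power θ n m.divNat a)

/-- A finite word is allowed if it occurs in `θ^n(a)` for some letter `a` and some `n`. -/
def Allowed (θ : Substitution ℓ A) (w : List A) : Prop :=
  ∃ (n : ℕ) (a : A), w <:+: θ.onWord^[n] [a]

/-- The set of bi-infinite sequences all of whose finite subwords are allowed. -/
def shiftSpace (θ : Substitution ℓ A) : Set (ℤ → A) :=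
  {x | ∀ (i : ℤ) (n : ℕ), θ.Allowed (List.ofFn fun j : Fin n => x (i + (j : ℕ)))}

/-- The substitution shift `X_θ`; its topology is the subspace topology of the product topology. -/
abbrev X (θ : Substitution ℓ A) : Type u := θ.shiftSpace

/-- The left shift on `X_θ`. -/
def shift (θ : Substitution ℓ A) (x : θ.X) : θ.X :=
  ⟨fun i => x.1 (i + 1), fun i n => by
    have h := x.2 (i + 1) n
    have e : (fun j : Fin n => x.1 (i + 1 + (j : ℕ))) =
        fun j : Fin n => x.1 (i + (j : ℕ) + 1) := by
      funext j
      rw [add_right_comm]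
    rw [e] at h
    exact h⟩

/-- Primitivity. -/
def Primitive (θ : Substitution ℓ A) : Prop :=
  ∃ n : ℕ, ∀ a b : A, b ∈ θ.onWord^[n] [a]

/-- Aperiodicity: `X_θ` contains no shift-periodic sequence. -/
def Aperiodic (θ : Substitution ℓ A) : Prop :=
  ∀ (x : θ.X) (n : ℕ), 0 < n → θ.shift^[n] x ≠ x

/-- A point of `X_θ` is `θ`-periodic if `θ^n(x) = x` for some `n ≥ 1`. -/
def IsPeriodicPoint [NeZero ℓ] (θ : Substitution ℓ A) (x : θ.X) : Prop :=
  ∃ n : ℕ, 0 < n ∧ θ.onSeq^[n] x.1 = x.1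

theorem onWord_infix (θ : Substitution ℓ A) {v w : List A} (h : v <:+: w) :
    θ.onWord v <:+: θ.onWord w := by
  obtain ⟨s, t, rfl⟩ := h
  exact ⟨θ.onWord s, θ.onWord t, by simp [onWord]⟩

theorem Allowed.onWord {θ : Substitution ℓ A} {w : List A} (h : θ.Allowed w) :
    θ.Allowed (θ.onWord w) := by
  obtain ⟨n, a, h⟩ := h
  refine ⟨n + 1, a, ?_⟩
  rw [Function.iterate_succ_apply']
  exact θ.onWord_infix h

theorem length_onWord_pair (θ : Substitution ℓ A) (a b : A) :
    (θ.onWord [a, b]).length = 2 * ℓ := by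
  simp [Substitution.onWord, onLetter, two_mul]

theorem pair_infix (l : List A) (t : ℕ) (h : t + 1 < l.length) :
    [l[t], l[t + 1]] <:+: l := by
  refine ⟨l.take t, l.drop (t + 2), ?_⟩
  have h1 : l.drop t = l[t] :: l[t + 1] :: l.drop (t + 2) := by
    rw [List.drop_eq_getElem_cons (by omega), List.drop_eq_getElem_cons h]
  calc l.take t ++ [l[t], l[t + 1]] ++ l.drop (t + 2)
      = l.take t ++ l.drop t := by rw [h1]; simp
    _ = l := List.take_append_drop t l

/-- The set of allowed two-letter words of `θ`. -/
abbrev TwoWords (θ : Substitution ℓ A) : Type u := {w : A × A // θ.Allowed [w.1, w.2]}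

/-- The `k`-shifted extension `θ^{(+k)}`, `0 ≤ k < ℓ`: its alphabet is the set of allowed
two-letter words, and `(θ^{(+k)})_m (a_0 a_1) = a'_{m+k} a'_{m+k+1}`, where
`a'_0 ⋯ a'_{2ℓ-1} = θ(a_0 a_1)`. -/
def shiftedExt (θ : Substitution ℓ A) (k : Fin ℓ) : Substitution ℓ θ.TwoWords := fun m w =>
  have h : (m : ℕ) + k + 1 < (θ.onWord [w.1.1, w.1.2]).length := by
    rw [length_onWord_pair]; omega
  ⟨((θ.onWord [w.1.1, w.1.2])[(m : ℕ) + k], (θ.onWord [w.1.1, w.1.2])[(m : ℕ) + k + 1]), by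
    obtain ⟨n, a, hn⟩ := w.2.onWord
    exact ⟨n, a, (pair_infix _ _ h).trans hn⟩⟩

end Substitution

/-- The ring `ℤ_ℓ = lim ℤ/ℓ^n ℤ` of `ℓ`-adic integers (`ℓ` need not be prime). -/
def adicSubring (ℓ : ℕ) : Subring (∀ n : ℕ, ZMod (ℓ ^ n)) where
  carrier := {x | ∀ n, ZMod.castHom (pow_dvd_pow ℓ n.le_succ) (ZMod (ℓ ^ n)) (x (n + 1)) = x n}
  mul_mem' := fun {x y} hx hy n => by
    rw [Pi.mul_apply, Pi.mul_apply, map_mul, hx n, hy n]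
  one_mem' := fun n => by rw [Pi.one_apply, Pi.one_apply, map_one]
  add_mem' := fun {x y} hx hy n => by
    rw [Pi.add_apply, Pi.add_apply, map_add, hx n, hy n]
  zero_mem' := fun n => by rw [Pi.zero_apply, Pi.zero_apply, map_zero]
  neg_mem' := fun {x} hx n => by
    rw [Pi.neg_apply, Pi.neg_apply, map_neg, hx n]

/-- The `ℓ`-adic integers, as a type. The topology is the inverse limit topology: that of a
subspace of the product of the discrete spaces `ℤ/ℓ^n ℤ`. -/
abbrev ZAdic (ℓ : ℕ) : Type := adicSubring ℓ

/-- An integer coprime to `ℓ` is invertible in `ℤ_ℓ`. -/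
theorem ZAdic.isUnit_intCast {ℓ : ℕ} {q : ℤ} (h : IsCoprime q (ℓ : ℤ)) :
    IsUnit (q : ZAdic ℓ) := by
  have hu : ∀ n : ℕ, IsUnit ((q : ℤ) : ZMod (ℓ ^ n)) := fun n => by
    obtain ⟨a, b, hab⟩ := h.pow_right (n := n)
    refine IsUnit.of_mul_eq_one (a : ZMod (ℓ ^ n)) ?_
    have := congrArg (Int.cast : ℤ → ZMod (ℓ ^ n)) hab
    push_cast at this
    have h0 : ((ℓ : ZMod (ℓ ^ n)) ^ n) = 0 := by
      exact_mod_cast ZMod.natCast_self (ℓ ^ n)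
    rw [h0, mul_zero, add_zero] at this
    rw [mul_comm]
    exact this
  choose v hv using fun n => (hu n).exists_right_inv
  have hmem : v ∈ adicSubring ℓ := fun n => by
    set c := ZMod.castHom (pow_dvd_pow ℓ n.le_succ) (ZMod (ℓ ^ n))
    have h1 := congrArg c (hv (n + 1))
    rw [map_mul, map_intCast, map_one] at h1
    exact (hu n).mul_left_cancel (h1.trans (hv n).symm)
  refine IsUnit.of_mul_eq_one ⟨v, hmem⟩ ?_
  apply Subtype.ext
  funext n
  have := hv n
  simpa using this

/-- `1 - ℓ` is invertible in `ℤ_ℓ`. -/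
theorem ZAdic.isUnit_one_sub (ℓ : ℕ) : IsUnit (1 - (ℓ : ZAdic ℓ)) := by
  have h : IsCoprime (1 - (ℓ : ℤ)) (ℓ : ℤ) := ⟨1, 1, by ring⟩
  simpa using ZAdic.isUnit_intCast h

namespace Substitution

section Dynamics

variable {L M : ℕ} {A B : Type u} [TopologicalSpace A] [TopologicalSpace B]

/-- A conjugacy `X_θ → X_η`: an injective factor map, i.e. a continuous bijection that
intertwines the shifts. -/
structure IsConjugacy (θ : Substitution L A) (η : Substitution M B) (F : θ.X → η.X) : Prop where
  continuous : Continuous F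
  bijective : Function.Bijective F
  shift : ∀ x, F (θ.shift x) = η.shift (F x)

/-- `π` is a factor map from `(X_θ, σ)` onto the odometer `(ℤ_ℓ, +1)`. -/
structure IsOdometerFactorMap (ℓ : ℕ) (θ : Substitution L A) (π : θ.X → ZAdic ℓ) : Prop where
  continuous : Continuous π
  surjective : Function.Surjective π
  shift : ∀ x, π (θ.shift x) = π x + 1

/-- The normalised factor map onto `(ℤ_ℓ, +1)`: the fibre over `0` is the set of `θ`-periodic
points (which are the fixed points of a suitable power of `θ`).  The length `L` of `θ` is allowed
to be a power of `ℓ`, in which case `ℤ_L = ℤ_ℓ`. -/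
structure IsNormalisedFactorMap [NeZero L] (ℓ : ℕ) (θ : Substitution L A)
    (π : θ.X → ZAdic ℓ) : Prop extends IsOdometerFactorMap ℓ θ π where
  eq_zero_iff : ∀ x, π x = 0 ↔ θ.IsPeriodicPoint x

/-- `F : X_θ → X_η` has `κ`-value `z`: normalised factor maps of `X_θ` and of `X_η` onto
`(ℤ_ℓ, +1)` exist, and `π_η (F x) = z + π_θ x` for all `x` (whichever normalised maps are used). -/
def HasKappaValue [NeZero L] [NeZero M] (ℓ : ℕ) (θ : Substitution L A) (η : Substitution M B)
    (F : θ.X → η.X) (z : ZAdic ℓ) : Prop :=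
  (∃ π, IsNormalisedFactorMap ℓ θ π) ∧ (∃ π, IsNormalisedFactorMap ℓ η π) ∧
  ∀ (π₁ : θ.X → ZAdic ℓ) (π₂ : η.X → ZAdic ℓ),
    IsNormalisedFactorMap ℓ θ π₁ → IsNormalisedFactorMap ℓ η π₂ →
    ∀ x, π₂ (F x) = z + π₁ x

/-- `(ℤ_ℓ, +1)` is the maximal equicontinuous factor of `(X_θ, σ)`: some factor map `π` onto it
is such that every factor map from `X_θ` onto an equicontinuous compact system factors
continuously through `π`. For an aperiodic primitive `θ` of length `ℓ` (or a power of `ℓ`) this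
says that `θ` has trivial height. -/
def TrivialHeight (ℓ : ℕ) (θ : Substitution L A) : Prop :=
  ∃ π : θ.X → ZAdic ℓ, IsOdometerFactorMap ℓ θ π ∧
    ∀ (Z : Type u) [MetricSpace Z] [CompactSpace Z] (T : Z ≃ₜ Z) (g : θ.X → Z),
      Equicontinuous (fun n : ℤ => ⇑(T ^ n)) →
      Continuous g → Function.Surjective g → (∀ x, g (θ.shift x) = T (g x)) →
      ∃ h : ZAdic ℓ → Z, Continuous h ∧ ∀ x, g x = h (π x)

end Dynamics

end Substitution

/-! Everything rests on one intertwining relation. Passing from a point `x` to the sequence of its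
overlapping two-letter words (`pairing`) turns `σ^k ∘ η` into the shifted extension `ζ` of `η`
(`onSeq_pairing`), where `η` is a power of `θ` of length `L`. Since two-letter coding is invertible,
`X_ζ` is exactly the coded copy of `X_θ`, and reading first letters is a conjugacy.

The `κ`-value comes from comparing zero fibres. Recognizability (`InLevel.dvd_sub`) gives each `x` a
unique phase modulo every `ℓ^n`, hence a map `π` to `ℤ_ℓ` with `π(σ^m x) = m + π(x)` and `π(θ^j x) =
ℓ^j π(x)`. Its zero fibre is the set of `θ`-periodic points. A coded point is `ζ`-periodic exactly
when `x` is periodic under `σ^k ∘ η`. Solving `π(x) = k + L π(x)` shows that such points lie over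
`k/(1 - L)`, so subtracting this constant normalises the map on `X_ζ`. Minimality makes normalised
maps unique.

For `p/q`, Euler's theorem gives `q ∣ ℓ^{φ(q)} - 1`. Division with remainder then writes `p/q = m +
k/(1 - L)` with `L = ℓ^{φ(q)}`, and composing the code with `σ^m` supplies the integer part. Trivial
height passes across any conjugacy. -/

namespace Substitution

/-! ### Windows of bi-infinite sequences and the action of a substitution on them. -/

section Words

variable {ℓ : ℕ} {A : Type u}

/-- The translate of a bi-infinite sequence by `r` places to the left. -/
def translate (r : ℤ) (x : ℤ → A) : ℤ → A := fun i => x (i + r)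

/-- The word of length `n` of `x` that starts at position `i`. -/
def window (x : ℤ → A) (i : ℤ) (n : ℕ) : List A := List.ofFn fun j : Fin n => x (i + (j : ℕ))

@[simp]
theorem translate_zero (x : ℤ → A) : translate 0 x = x := by
  funext i; simp [translate]

theorem translate_translate (r s : ℤ) (x : ℤ → A) :
    translate r (translate s x) = translate (r + s) x := by
  funext i; simp [translate, add_assoc]

@[simp]
theorem length_window (x : ℤ → A) (i : ℤ) (n : ℕ) : (window x i n).length = n := by
  simp [window]

@[simp]
theorem getElem_window (x : ℤ → A) (i : ℤ) (n t : ℕ) (h : t < (window x i n).length) :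
    (window x i n)[t] = x (i + t) := by
  simp [window]

theorem window_eq_iff {x y : ℤ → A} {i j : ℤ} {n : ℕ} :
    window x i n = window y j n ↔ ∀ t : ℕ, t < n → x (i + t) = y (j + t) := by
  constructor
  · intro h t ht
    have h1 := List.getElem_of_eq h (i := t) (by simpa using ht)
    simpa using h1
  · intro h
    refine List.ext_getElem (by simp) fun t h1 _ => ?_
    simpa using h t (by simpa using h1)

theorem window_translate (r : ℤ) (x : ℤ → A) (i : ℤ) (n : ℕ) :
    window (translate r x) i n = window x (i + r) n := by
  rw [window_eq_iff]
  intro t _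
  simp only [translate]
  congr 1
  ring

theorem window_add (x : ℤ → A) (i : ℤ) (a b : ℕ) :
    window x i (a + b) = window x i a ++ window x (i + a) b := by
  refine List.ext_getElem (by simp) fun t h1 h2 => ?_
  rw [List.getElem_append]
  split_ifs with h
  · simp
  · simp only [getElem_window, length_window] at h ⊢
    congr 1
    push_cast [Nat.cast_sub (not_lt.1 h)]
    ring

theorem window_two (x : ℤ → A) (i : ℤ) : window x i 2 = [x i, x (i + 1)] := by
  simp [window, List.ofFn_succ]

theorem window_one (x : ℤ → A) (i : ℤ) : window x i 1 = [x i] := by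
  simp [window, List.ofFn_succ]

theorem infix_window_iff {w : List A} {x : ℤ → A} {i : ℤ} {m : ℕ} :
    w <:+: window x i m ↔
      ∃ j : ℕ, j + w.length ≤ m ∧ w = window x (i + j) w.length := by
  constructor
  · rintro ⟨s, t, h⟩
    have hl := congrArg List.length h
    simp only [List.length_append, length_window] at hl
    refine ⟨s.length, by omega, List.ext_getElem (by simp) fun n h1 _ => ?_⟩
    have h2 := List.getElem_of_eq h (i := s.length + n) (by simp; omega)
    rw [List.getElem_append_left (by simp; omega), List.getElem_append_right (by omega)] at h2
    simp only [Nat.add_sub_cancel_left, getElem_window] at h2 ⊢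
    rw [h2]
    congr 1
    push_cast
    ring
  · rintro ⟨j, hj, h⟩
    obtain ⟨c, rfl⟩ := Nat.exists_eq_add_of_le hj
    rw [window_add, window_add, ← h]
    exact ⟨_, _, rfl⟩

theorem window_infix_window {x : ℤ → A} {i j : ℤ} {n m : ℕ} (h1 : i ≤ j)
    (h2 : j + n ≤ i + m) : window x j n <:+: window x i m := by
  refine infix_window_iff.2 ⟨(j - i).toNat, by simp; omega, ?_⟩
  rw [length_window, Int.toNat_of_nonneg (by omega)]
  congr 1
  ring

theorem Allowed.of_infix {θ : Substitution ℓ A} {v w : List A} (hw : θ.Allowed w)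
    (h : v <:+: w) : θ.Allowed v := by
  obtain ⟨n, a, hn⟩ := hw
  exact ⟨n, a, h.trans hn⟩

theorem mem_shiftSpace_iff {θ : Substitution ℓ A} {x : ℤ → A} :
    x ∈ θ.shiftSpace ↔ ∀ i n, θ.Allowed (window x i n) := Iff.rfl

theorem translate_mem {θ : Substitution ℓ A} {x : ℤ → A} (hx : x ∈ θ.shiftSpace) (r : ℤ) :
    translate r x ∈ θ.shiftSpace := fun i n => by
  have := hx (i + r) n
  rwa [← window, ← window_translate] at this

theorem onWord_iterate_infix (θ : Substitution ℓ A) {v w : List A} (h : v <:+: w) (n : ℕ) :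
    θ.onWord^[n] v <:+: θ.onWord^[n] w := by
  induction n with
  | zero => exact h
  | succ n ih =>
    rw [Function.iterate_succ_apply', Function.iterate_succ_apply']
    exact θ.onWord_infix ih

variable [NeZero ℓ]

theorem length_pos (ℓ : ℕ) [NeZero ℓ] (n : ℕ) : (0 : ℤ) < (ℓ : ℤ) ^ n := by
  have : (0 : ℤ) < ℓ := by exact_mod_cast Nat.pos_of_ne_zero (NeZero.ne ℓ)
  positivity

theorem onSeq_apply (θ : Substitution ℓ A) (x : ℤ → A) (i : ℤ) (m : Fin ℓ) :
    θ.onSeq x (ℓ * i + (m : ℕ)) = θ m (x i) := by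
  have hm : ((m : ℕ) : ℤ) < ℓ := by exact_mod_cast m.2
  have h1 : (ℓ * i + (m : ℕ) : ℤ) % ℓ = (m : ℕ) := by
    rw [Int.mul_add_emod_self_left, Int.emod_eq_of_lt (by positivity) hm]
  have h2 : (ℓ * i + (m : ℕ) : ℤ) / ℓ = i := by
    have h0 : (ℓ : ℤ) ≠ 0 := by have := m.pos; omega
    rw [Int.mul_add_ediv_left _ _ h0, Int.ediv_eq_zero_of_lt (by positivity) hm, add_zero]
  unfold onSeq
  congr 1
  · ext
    simp only [h1, Int.toNat_natCast]
  · rw [h2]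

theorem onSeq_congr (θ : Substitution ℓ A) {x y : ℤ → A} {i j : ℤ}
    (hm : i % ℓ = j % ℓ) (h : x (i / ℓ) = y (j / ℓ)) : θ.onSeq x i = θ.onSeq y j := by
  unfold onSeq
  simp only [hm, h]

theorem onSeq_iterate_congr (θ : Substitution ℓ A) {x y : ℤ → A} (n : ℕ) {i : ℤ}
    (h : x (i / (ℓ : ℤ) ^ n) = y (i / (ℓ : ℤ) ^ n)) :
    θ.onSeq^[n] x i = θ.onSeq^[n] y i := by
  induction n generalizing i with
  | zero => simpa using h
  | succ n ih =>
    rw [Function.iterate_succ_apply', Function.iterate_succ_apply']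
    refine θ.onSeq_congr rfl (ih ?_)
    rw [Int.ediv_ediv_of_nonneg (by positivity), ← pow_succ']
    exact h

theorem onSeq_translate (θ : Substitution ℓ A) (r : ℤ) (x : ℤ → A) :
    θ.onSeq (translate r x) = translate (ℓ * r) (θ.onSeq x) := by
  have h0 : (ℓ : ℤ) ≠ 0 := by exact_mod_cast NeZero.ne ℓ
  funext i
  refine θ.onSeq_congr (by simp) ?_
  rw [translate, Int.add_mul_ediv_left _ _ h0]

theorem onSeq_iterate_translate (θ : Substitution ℓ A) (n : ℕ) (r : ℤ) (x : ℤ → A) :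
    θ.onSeq^[n] (translate r x) = translate ((ℓ : ℤ) ^ n * r) (θ.onSeq^[n] x) := by
  induction n with
  | zero => simp
  | succ n ih =>
    rw [Function.iterate_succ_apply', Function.iterate_succ_apply', ih, onSeq_translate]
    congr 1
    ring

theorem onWord_window (θ : Substitution ℓ A) (x : ℤ → A) (i : ℤ) (n : ℕ) :
    θ.onWord (window x i n) = window (θ.onSeq x) (ℓ * i) (ℓ * n) := by
  induction n with
  | zero => simp [window, onWord]
  | succ n ih =>
    rw [window_add, mul_add, window_add, ← ih, onWord, onWord, List.flatMap_append]
    congr 1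
    rw [window_one, List.flatMap_singleton, onLetter, mul_one, window]
    congr 1
    funext m
    rw [← θ.onSeq_apply]
    congr 1
    push_cast
    ring

theorem onWord_iterate_window (θ : Substitution ℓ A) (x : ℤ → A) (i : ℤ) (m n : ℕ) :
    θ.onWord^[n] (window x i m) =
      window (θ.onSeq^[n] x) ((ℓ : ℤ) ^ n * i) (ℓ ^ n * m) := by
  induction n with
  | zero => simp
  | succ n ih =>
    rw [Function.iterate_succ_apply', ih, onWord_window, Function.iterate_succ_apply']
    congr 1
    · ring
    · ring

theorem onWord_iterate_singleton (θ : Substitution ℓ A) (x : ℤ → A) (i : ℤ) (n : ℕ) :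
    θ.onWord^[n] [x i] = window (θ.onSeq^[n] x) ((ℓ : ℤ) ^ n * i) (ℓ ^ n) := by
  rw [← window_one, onWord_iterate_window, mul_one]

theorem onSeq_mem {θ : Substitution ℓ A} {x : ℤ → A} (hx : x ∈ θ.shiftSpace) :
    θ.onSeq x ∈ θ.shiftSpace := fun i n => by
  have h0 := length_pos ℓ 1
  rw [pow_one] at h0
  have h1 := (mem_shiftSpace_iff.1 hx (i / ℓ) (n + 1)).onWord
  rw [onWord_window] at h1
  refine h1.of_infix (window_infix_window (Int.mul_ediv_self_le h0.ne') ?_)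
  have h2 := Int.lt_mul_ediv_self_add (x := i) h0
  have h3 : (n : ℤ) ≤ ℓ * n := le_mul_of_one_le_left (by positivity) (by omega)
  push_cast
  linarith [mul_add (ℓ : ℤ) n 1]

theorem onSeq_iterate_mem {θ : Substitution ℓ A} {x : ℤ → A} (hx : x ∈ θ.shiftSpace) (n : ℕ) :
    θ.onSeq^[n] x ∈ θ.shiftSpace := by
  induction n with
  | zero => exact hx
  | succ n ih => rw [Function.iterate_succ_apply']; exact onSeq_mem ih

end Words

end Substitution

namespace Substitution

/-! ### Minimality, phases modulo `ℓ^n`, and linear recurrence. -/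

section Recurrence

variable {ℓ : ℕ} {A : Type u}

theorem length_onWord_iterate (θ : Substitution ℓ A) (w : List A) (n : ℕ) :
    (θ.onWord^[n] w).length = ℓ ^ n * w.length := by
  induction n with
  | zero => simp
  | succ n ih =>
    rw [Function.iterate_succ_apply', onWord, List.length_flatMap]
    simp [onLetter, ih]
    ring

theorem isClosed_shiftSpace [TopologicalSpace A] [DiscreteTopology A]
    (θ : Substitution ℓ A) : IsClosed θ.shiftSpace := by
  have : θ.shiftSpace = ⋂ (i : ℤ) (n : ℕ), (fun (x : ℤ → A) (j : Fin n) => x (i + (j : ℕ))) ⁻¹'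
      {f | θ.Allowed (List.ofFn f)} := by
    ext x
    simp [shiftSpace]
  rw [this]
  exact isClosed_iInter fun i => isClosed_iInter fun n =>
    (isClosed_discrete _).preimage (by fun_prop)

variable [NeZero ℓ]

/-- For a primitive substitution, an allowed word occurs in all large enough powers of all
letters. -/
theorem Primitive.exists_infix {θ : Substitution ℓ A} (hθ : θ.Primitive) {w : List A}
    (hw : θ.Allowed w) : ∃ N, ∀ n, N ≤ n → ∀ c, w <:+: θ.onWord^[n] [c] := by
  obtain ⟨p, a, hp⟩ := hw
  obtain ⟨N, hN⟩ := hθ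
  refine ⟨p + N, fun n hn c => ?_⟩
  obtain ⟨d, rfl⟩ := Nat.exists_eq_add_of_le hn
  rw [Function.iterate_add_apply, Function.iterate_add_apply]
  have hne : 0 < (θ.onWord^[d] [c]).length := by
    rw [length_onWord_iterate]
    have := Nat.pos_of_ne_zero (NeZero.ne ℓ)
    simp; positivity
  obtain ⟨c', hc'⟩ := List.exists_mem_of_length_pos hne
  have key : ∀ {b : A} {l : List A}, b ∈ l → [b] <:+: l := fun h => by
    obtain ⟨s, t, rfl⟩ := List.append_of_mem h
    exact ⟨s, t, by simp⟩
  refine hp.trans (θ.onWord_iterate_infix ?_ p)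
  exact (key (hN c' a)).trans (θ.onWord_iterate_infix (key hc') N)

/-- Uniform recurrence. -/
theorem Primitive.exists_infix_window {θ : Substitution ℓ A} (hℓ : 2 ≤ ℓ) (hθ : θ.Primitive)
    {w : List A} (hw : θ.Allowed w) :
    ∃ R : ℕ, ∀ y ∈ θ.shiftSpace, ∀ i : ℤ, w <:+: window y i R := by
  obtain ⟨n, hn⟩ := hθ.exists_infix hw
  -- Any window of length `2ℓ^n` inside some `θ^p(a)` with `p ≥ n` contains a complete block
  -- `θ^n(c)`.
  refine ⟨2 * ℓ ^ n, fun y hy i => ?_⟩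
  obtain ⟨p, a, hp⟩ := mem_shiftSpace_iff.1 hy i (2 * ℓ ^ n)
  have hl := hp.length_le
  have hpos : 0 < ℓ ^ n := by positivity
  rw [length_onWord_iterate, length_window, List.length_singleton, mul_one] at hl
  have hnp : n ≤ p := ((Nat.pow_lt_pow_iff_right hℓ).1 (by omega)).le
  obtain ⟨d, rfl⟩ := Nat.exists_eq_add_of_le hnp
  set x : ℤ → A := θ.onSeq^[d] fun _ => a
  have e : θ.onWord^[n + d] [a] = window (θ.onSeq^[n] x) 0 (ℓ ^ (n + d)) := by
    have := θ.onWord_iterate_singleton (fun _ => a) 0 (n + d)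
    rwa [mul_zero, Function.iterate_add_apply _ n d fun _ => a] at this
  rw [e, infix_window_iff] at hp
  obtain ⟨j, -, hj⟩ := hp
  rw [length_window, zero_add] at hj
  rw [hj]
  have hpos' := length_pos ℓ n
  have h1 := Int.mul_ediv_self_le (x := j) hpos'.ne'
  have h2 := Int.lt_mul_ediv_self_add (x := j) hpos'
  refine (hn n le_rfl (x ((j : ℤ) / (ℓ : ℤ) ^ n + 1))).trans ?_
  rw [onWord_iterate_singleton]
  refine window_infix_window ?_ ?_ <;> push_cast <;> linarith

/-- Every point of `X_θ` has a dense forward orbit. -/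
theorem Primitive.mem_of_forall_translate_mem [TopologicalSpace A] {θ : Substitution ℓ A}
    (hℓ : 2 ≤ ℓ) (hθ : θ.Primitive) {x y : ℤ → A} (hx : x ∈ θ.shiftSpace)
    (hy : y ∈ θ.shiftSpace) {C : Set (ℤ → A)} (hC : IsClosed C)
    (h : ∀ n : ℕ, translate n x ∈ C) : y ∈ C := by
  have key : ∀ N : ℕ, ∃ n : ℕ, ∀ i : ℤ, -N ≤ i → i ≤ N → x (i + n) = y i := fun N => by
    obtain ⟨R, hR⟩ := hθ.exists_infix_window hℓ (mem_shiftSpace_iff.1 hy (-N) (2 * N + 1))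
    obtain ⟨j, -, hj⟩ := infix_window_iff.1 (hR x hx N)
    rw [length_window, window_eq_iff] at hj
    refine ⟨2 * N + j, fun i h1 h2 => ?_⟩
    have h3 := hj (i + N).toNat (by omega)
    rw [Int.toNat_of_nonneg (by omega)] at h3
    rw [show i = -(N : ℤ) + (i + N) by ring, h3]
    congr 1
    push_cast
    ring
  choose n hn using key
  refine hC.mem_of_tendsto (f := fun N => translate (n N) x) (b := Filter.atTop) ?_
    (Filter.Eventually.of_forall fun N => h _)
  rw [tendsto_pi_nhds]
  intro i
  refine tendsto_const_nhds.congr' ?_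
  filter_upwards [Filter.eventually_ge_atTop i.natAbs] with N hN
  exact (hn N i (by omega) (by omega)).symm

section Closed

variable [TopologicalSpace A]

theorem continuous_translate (r : ℤ) : Continuous (translate r : (ℤ → A) → ℤ → A) := by
  unfold translate; fun_prop

variable [DiscreteTopology A]

theorem continuous_onSeq (θ : Substitution ℓ A) : Continuous θ.onSeq := by
  refine continuous_pi fun i => ?_
  exact continuous_of_discreteTopology.comp (continuous_apply _)

end Closed

/-- `x = σ^r(θ^n(y))` for some `y` in `X_θ`. -/
def InLevel (θ : Substitution ℓ A) (n : ℕ) (r : ℤ) (x : ℤ → A) : Prop :=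
  ∃ y ∈ θ.shiftSpace, x = translate r (θ.onSeq^[n] y)

theorem isClosed_inLevel [TopologicalSpace A] [DiscreteTopology A] [Finite A]
    (θ : Substitution ℓ A) (n : ℕ) (r : ℤ) : IsClosed {x | θ.InLevel n r x} := by
  have : {x | θ.InLevel n r x} =
      (fun y => translate r (θ.onSeq^[n] y)) '' θ.shiftSpace := by
    ext x
    simp [InLevel, eq_comm]
  rw [this]
  exact (θ.isClosed_shiftSpace.isCompact.image
    ((continuous_translate r).comp (θ.continuous_onSeq.iterate n))).isClosed

theorem InLevel.translate {θ : Substitution ℓ A} {n : ℕ} {r : ℤ} {x : ℤ → A}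
    (h : θ.InLevel n r x) (s : ℤ) : θ.InLevel n (s + r) (translate s x) := by
  obtain ⟨y, hy, rfl⟩ := h
  exact ⟨y, hy, translate_translate _ _ _⟩

theorem InLevel.of_dvd {θ : Substitution ℓ A} {n : ℕ} {r s : ℤ} {x : ℤ → A}
    (h : θ.InLevel n r x) (hd : (ℓ : ℤ) ^ n ∣ r - s) : θ.InLevel n s x := by
  obtain ⟨y, hy, rfl⟩ := h
  obtain ⟨c, hc⟩ := hd
  refine ⟨Substitution.translate c y, translate_mem hy c, ?_⟩
  rw [onSeq_iterate_translate, translate_translate, ← hc]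
  congr 1
  ring

theorem InLevel.mono {θ : Substitution ℓ A} {m n : ℕ} {r : ℤ} {x : ℤ → A}
    (h : θ.InLevel n r x) (hm : m ≤ n) : θ.InLevel m r x := by
  obtain ⟨y, hy, rfl⟩ := h
  obtain ⟨d, rfl⟩ := Nat.exists_eq_add_of_le hm
  exact ⟨_, onSeq_iterate_mem hy d, by rw [Function.iterate_add_apply]⟩

theorem InLevel.onSeq {θ : Substitution ℓ A} {n : ℕ} {r : ℤ} {x : ℤ → A}
    (h : θ.InLevel n r x) : θ.InLevel (n + 1) (ℓ * r) (θ.onSeq x) := by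
  obtain ⟨y, hy, rfl⟩ := h
  exact ⟨y, hy, by rw [onSeq_translate, Function.iterate_succ_apply']⟩

/-- The orbit of `θ^n(x)` visits only finitely many phase classes, each closed by compactness, and
it is dense. -/
theorem Primitive.exists_inLevel [TopologicalSpace A] [DiscreteTopology A] [Finite A]
    {θ : Substitution ℓ A} (hℓ : 2 ≤ ℓ) (hθ : θ.Primitive) {x : ℤ → A}
    (hx : x ∈ θ.shiftSpace) (n : ℕ) : ∃ r : ℕ, r < ℓ ^ n ∧ θ.InLevel n r x := by
  have hpos : 0 < ℓ ^ n := by positivity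
  have hC : IsClosed (⋃ r ∈ Finset.range (ℓ ^ n), {x | θ.InLevel n (r : ℕ) x}) :=
    isClosed_biUnion_finset fun r _ => θ.isClosed_inLevel n r
  have := hθ.mem_of_forall_translate_mem hℓ (onSeq_iterate_mem hx n) hx hC fun m => by
    simp only [Set.mem_iUnion, Finset.mem_range]
    refine ⟨m % ℓ ^ n, Nat.mod_lt _ hpos, InLevel.of_dvd (r := m) ⟨x, hx, rfl⟩ ?_⟩
    push_cast
    exact Int.dvd_self_sub_emod
  simpa using this

/-- Linear recurrence. -/
theorem Primitive.linearlyRecurrent [Finite A] {θ : Substitution ℓ A} (hℓ : 2 ≤ ℓ)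
    (hθ : θ.Primitive) :
    ∃ K : ℕ, ∀ (n : ℕ) (w : List A), θ.Allowed w → w.length ≤ ℓ ^ n →
      ∀ x ∈ θ.shiftSpace, ∀ i : ℤ, w <:+: window x i (K * ℓ ^ n) := by
  let _ : TopologicalSpace A := ⊥
  have _ : DiscreteTopology A := ⟨rfl⟩
  have _ := Fintype.ofFinite A
  have key : ∀ p : A × A, ∃ R : ℕ, θ.Allowed [p.1, p.2] →
      ∀ y ∈ θ.shiftSpace, ∀ i : ℤ, [p.1, p.2] <:+: window y i R := fun p => by
    by_cases h : θ.Allowed [p.1, p.2]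
    · obtain ⟨R, hR⟩ := hθ.exists_infix_window hℓ h
      exact ⟨R, fun _ => hR⟩
    · exact ⟨0, fun h' => absurd h' h⟩
  choose R hR using key
  set S := Finset.univ.sup R
  -- A word of length at most `ℓ^n` meets at most two consecutive `n`-blocks, so it lies in `θ^n` of
  -- an allowed pair. Pairs recur within `S` letters, and the extra block allows for alignment.
  refine ⟨S + 1, fun n w hw hwn x hx i => ?_⟩
  have hpos' := length_pos ℓ n
  obtain ⟨R', hR'⟩ := hθ.exists_infix_window hℓ hw
  obtain ⟨j, -, hj⟩ := infix_window_iff.1 (hR' x hx 0)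
  obtain ⟨r, -, y, hy, rfl⟩ := hθ.exists_inLevel hℓ hx n
  rw [window_translate] at hj
  set t : ℤ := 0 + j + r
  have h1 := Int.mul_ediv_self_le (x := t) hpos'.ne'
  have h2 := Int.lt_mul_ediv_self_add (x := t) hpos'
  have h3 : w <:+: θ.onWord^[n] (window y (t / (ℓ : ℤ) ^ n) 2) := by
    rw [onWord_iterate_window, hj]
    refine window_infix_window h1 ?_
    have : (w.length : ℤ) ≤ (ℓ : ℤ) ^ n := by exact_mod_cast hwn
    push_cast
    linarith
  have h4 := hR (y (t / (ℓ : ℤ) ^ n), y (t / (ℓ : ℤ) ^ n + 1)) (by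
    rw [← window_two]; exact hy _ _) y hy ((i + r) / (ℓ : ℤ) ^ n + 1)
  rw [← window_two] at h4
  have h5 := h4.trans (window_infix_window (m := S) le_rfl (by
    have : R (y (t / (ℓ : ℤ) ^ n), y (t / (ℓ : ℤ) ^ n + 1)) ≤ S :=
      Finset.le_sup (f := R) (Finset.mem_univ _)
    gcongr))
  refine (h3.trans (θ.onWord_iterate_infix h5 n)).trans ?_
  rw [onWord_iterate_window, window_translate]
  have h6 := Int.mul_ediv_self_le (x := i + r) hpos'.ne'
  have h7 := Int.lt_mul_ediv_self_add (x := i + r) hpos'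
  refine window_infix_window ?_ ?_ <;> push_cast <;> linarith

end Recurrence

end Substitution

namespace Substitution

/-! ### Recognizability, by counting phases. -/

section Recognizability

variable {ℓ : ℕ} {A : Type u}

theorem shift_iterate_val (θ : Substitution ℓ A) (x : θ.X) (n : ℕ) :
    (θ.shift^[n] x).1 = translate n x.1 := by
  induction n with
  | zero => simp
  | succ n ih =>
    rw [Function.iterate_succ_apply']
    funext i
    change (θ.shift^[n] x).1 (i + 1) = _
    rw [ih]
    exact congrArg x.1 (by push_cast; ring)

variable [NeZero ℓ]

/-- The powers that occur in an aperiodic primitive substitution shift are bounded. -/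
theorem Primitive.exists_bound_of_period [Finite A] {θ : Substitution ℓ A} (hℓ : 2 ≤ ℓ)
    (hθ : θ.Primitive) (ha : θ.Aperiodic) :
    ∃ K : ℕ, ∀ (e d : ℕ), 0 < d → d + 1 ≤ ℓ ^ e → ∀ x ∈ θ.shiftSpace, ∀ i : ℤ,
      ¬ ∀ t : ℕ, t < K * ℓ ^ e → x (i + t) = x (i + t + d) := by
  obtain ⟨K, hK⟩ := hθ.linearlyRecurrent hℓ
  -- A stretch of length `K ℓ^e` contains every word of length `d + 1` of `x`, so a period `d` on it
  -- spreads to all of `x`.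
  refine ⟨K, fun e d hd hde x hx i h => ha ⟨x, hx⟩ d hd (Subtype.ext ?_)⟩
  rw [shift_iterate_val]
  funext j
  have h1 := hK e (window x j (d + 1)) (hx _ _) (by simpa using hde) x hx i
  obtain ⟨t, ht, h2⟩ := infix_window_iff.1 h1
  rw [length_window] at ht h2
  rw [window_eq_iff] at h2
  have h3 := h2 0 (by omega)
  have h4 := h2 d (by omega)
  have h5 := h t (by omega)
  simp only [translate]
  simp only [Nat.cast_zero, add_zero] at h3
  rw [h3, h4, h5]

/-- One coincidence of the phases `0` and `s` propagates: the condition is closed and holds along a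
dense orbit, so phase `s` is redundant everywhere. -/
theorem InLevel.translate_of_inLevel [Finite A] {θ : Substitution ℓ A} (hℓ : 2 ≤ ℓ)
    (hθ : θ.Primitive) {n : ℕ} {s : ℤ} {x z : ℤ → A} (h1 : θ.InLevel n 0 x)
    (h2 : θ.InLevel n s x) (hz : θ.InLevel n s z) : θ.InLevel n 0 z := by
  let _ : TopologicalSpace A := ⊥
  have _ : DiscreteTopology A := ⟨rfl⟩
  obtain ⟨y, hy, rfl⟩ := h2
  obtain ⟨v, hv, rfl⟩ := hz
  have hC : IsClosed ((fun y => Substitution.translate s (θ.onSeq^[n] y)) ⁻¹'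
      {x | θ.InLevel n 0 x}) :=
    (θ.isClosed_inLevel n 0).preimage
      ((continuous_translate s).comp (θ.continuous_onSeq.iterate n))
  refine hθ.mem_of_forall_translate_mem hℓ hy hv hC fun m => ?_
  have h3 := h1.translate ((ℓ : ℤ) ^ n * m)
  rw [Set.mem_preimage, onSeq_iterate_translate, translate_translate]
  rw [translate_translate] at h3
  rw [add_comm s]
  exact h3.of_dvd (by simp)

/-- Desubstituting repeatedly makes a saving in phases multiplicative: `|D|^m` phases suffice at
level `n * m`. -/
theorem exists_cover {θ : Substitution ℓ A} {n : ℕ} {D : Finset ℤ}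
    (h : ∀ x ∈ θ.shiftSpace, ∃ r ∈ D, θ.InLevel n r x) (m : ℕ) :
    ∃ S : Finset ℤ, S.card ≤ D.card ^ m ∧
      ∀ x ∈ θ.shiftSpace, ∃ r ∈ S, θ.InLevel (n * m) r x := by
  classical
  induction m with
  | zero => exact ⟨{0}, by simp, fun x hx => ⟨0, by simp, x, hx, by simp⟩⟩
  | succ m ih =>
    obtain ⟨S, hS, hc⟩ := ih
    refine ⟨(S ×ˢ D).image fun p => p.1 + (ℓ : ℤ) ^ (n * m) * p.2, ?_, fun x hx => ?_⟩
    · refine Finset.card_image_le.trans ?_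
      rw [Finset.card_product, pow_succ]
      gcongr
    · obtain ⟨r, hr, y, hy, rfl⟩ := hc x hx
      obtain ⟨d, hd, v, hv, rfl⟩ := h y hy
      refine ⟨_, Finset.mem_image_of_mem _ (Finset.mk_mem_product hr hd), v, hv, ?_⟩
      rw [onSeq_iterate_translate, translate_translate, mul_add, mul_one,
        Function.iterate_add_apply]

theorem exists_mul_pow_le (C g : ℕ) : ∃ m : ℕ, C * g ^ m ≤ (g + 1) ^ m := by
  rcases Nat.eq_zero_or_pos g with rfl | hg
  · exact ⟨1, by simp⟩
  · have hg' : (0 : ℚ) < g := by exact_mod_cast hg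
    obtain ⟨m, hm⟩ := pow_unbounded_of_one_lt (C : ℚ)
      (show (1 : ℚ) < (g + 1) / g by rw [lt_div_iff₀ hg']; linarith)
    refine ⟨m, ?_⟩
    rw [div_pow, lt_div_iff₀ (by positivity)] at hm
    exact_mod_cast hm.le

/-- With even one phase missing, `(ℓ^n - 1)^m` phases suffice at level `n * m`, negligible against
`ℓ^{nm}`. By pigeonhole two nearby positions share phase and letter, so the same long block occurs
at two places a short distance apart. This forces a longer repetition than aperiodicity permits. -/
theorem Primitive.exists_notMem_cover [Finite A] {θ : Substitution ℓ A} (hℓ : 2 ≤ ℓ)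
    (hθ : θ.Primitive) (ha : θ.Aperiodic) {x : ℤ → A} (hx : x ∈ θ.shiftSpace) {n : ℕ}
    {D : Finset ℤ} (hD : D.card + 1 = ℓ ^ n) :
    ¬ ∀ x ∈ θ.shiftSpace, ∃ r ∈ D, θ.InLevel n r x := by
  classical
  intro h
  have _ := Fintype.ofFinite A
  obtain ⟨K, hK⟩ := hθ.exists_bound_of_period hℓ ha
  set g := D.card
  set a := Fintype.card A
  -- With `e = n * m - c`, a block of length `ℓ^{nm}` has length at least `K ℓ^e`, while `m` is
  -- chosen so that `|A| g^m + 1 ≤ ℓ^e` bounds the distance.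
  obtain ⟨c, hc⟩ : ∃ c, K ≤ ℓ ^ c := ⟨K, (Nat.lt_pow_self hℓ).le⟩
  obtain ⟨m, hm⟩ := exists_mul_pow_le ((a + 1) * ℓ ^ c) g
  obtain ⟨S, hS, hcov⟩ := exists_cover h m
  have hgm : (g + 1) ^ m = ℓ ^ (n * m) := by rw [hD, pow_mul]
  rw [hgm] at hm
  have hSpos : 0 < S.card := by
    obtain ⟨r, hr, -⟩ := hcov x hx
    exact Finset.card_pos.2 ⟨r, hr⟩
  have hgpos : 0 < g ^ m := hSpos.trans_le hS
  have hcle : c ≤ n * m := by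
    refine (Nat.pow_le_pow_iff_right hℓ).1 (le_trans ?_ hm)
    calc ℓ ^ c = 1 * ℓ ^ c * 1 := by ring
      _ ≤ (a + 1) * ℓ ^ c * g ^ m := by gcongr <;> omega
  obtain ⟨e, he⟩ := Nat.exists_eq_add_of_le hcle
  have hbound : a * g ^ m + 1 ≤ ℓ ^ e := by
    have hpos : 0 < ℓ ^ c := by positivity
    refine Nat.le_of_mul_le_mul_left ?_ hpos
    rw [← pow_add, ← he]
    refine le_trans ?_ hm
    calc ℓ ^ c * (a * g ^ m + 1) ≤ ℓ ^ c * (a * g ^ m + g ^ m) := by gcongr; omega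
      _ = _ := by ring
  have hpt : ∀ j : ℕ, ∃ p : ℤ × A, p.1 ∈ S ∧ ∃ y : ℤ → A, y 0 = p.2 ∧
      translate j x = translate p.1 (θ.onSeq^[n * m] y) := fun j => by
    obtain ⟨r, hr, y, -, hy⟩ := hcov _ (translate_mem hx j)
    exact ⟨(r, y 0), hr, y, rfl, hy⟩
  choose f hf hy using hpt
  obtain ⟨i, hi, j, hj, hij, hfij⟩ := Finset.exists_ne_map_eq_of_card_lt_of_maps_to
    (s := Finset.range (a * g ^ m + 1)) (t := S ×ˢ Finset.univ) (f := f)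
    (by
      rw [Finset.card_product, Finset.card_range, Finset.card_univ, mul_comm]
      exact Nat.lt_succ_of_le (by gcongr))
    (fun i _ => by simpa using hf i)
  wlog hlt : i < j generalizing i j
  · exact this j hj i hi hij.symm hfij.symm (by omega)
  simp only [Finset.mem_range] at hi hj
  obtain ⟨y, hy0, hyx⟩ := hy i
  obtain ⟨y', hy0', hyx'⟩ := hy j
  rw [hfij] at hy0 hyx
  refine hK e (j - i) (by omega) (by omega) x hx (i - (f j).1) fun t ht => ?_
  have ht' : (t : ℤ) < (ℓ : ℤ) ^ (n * m) := by
    have : t < ℓ ^ (n * m) := by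
      rw [he, pow_add]
      exact ht.trans_le (by gcongr)
    exact_mod_cast this
  have e1 := congrFun hyx (t - (f j).1)
  have e2 := congrFun hyx' (t - (f j).1)
  simp only [translate, sub_add_cancel] at e1 e2
  have e3 : θ.onSeq^[n * m] y t = θ.onSeq^[n * m] y' t := by
    refine θ.onSeq_iterate_congr _ ?_
    rw [Int.ediv_eq_zero_of_lt (by positivity) ht', hy0, hy0']
  rw [show (i : ℤ) - (f j).1 + t = t - (f j).1 + i by ring, e1, e3, ← e2]
  congr 1
  push_cast [Nat.cast_sub hlt.le]
  ring

/-- Recognizability: the phase of a point of `X_θ` modulo `ℓ^n` is unique. -/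
theorem InLevel.dvd_sub [Finite A] {θ : Substitution ℓ A} (hℓ : 2 ≤ ℓ)
    (hθ : θ.Primitive) (ha : θ.Aperiodic) {n : ℕ} {r s : ℤ} {x : ℤ → A}
    (hr : θ.InLevel n r x) (hs : θ.InLevel n s x) : (ℓ : ℤ) ^ n ∣ r - s := by
  classical
  let _ : TopologicalSpace A := ⊥
  have _ : DiscreteTopology A := ⟨rfl⟩
  by_contra hdvd
  have hx : x ∈ θ.shiftSpace := by
    obtain ⟨y, hy, rfl⟩ := hr
    exact translate_mem (onSeq_iterate_mem hy n) r
  have hpos := length_pos ℓ n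
  have h0 : θ.InLevel n 0 (Substitution.translate (-r) x) := by
    simpa using hr.translate (-r)
  have h1 : θ.InLevel n ((s - r) % (ℓ : ℤ) ^ n) (Substitution.translate (-r) x) :=
    (hs.translate (-r)).of_dvd (by
      rw [neg_add_eq_sub]
      exact Int.dvd_self_sub_emod)
  have hne : (s - r) % (ℓ : ℤ) ^ n ≠ 0 := fun h => hdvd (by
    rw [← neg_sub, dvd_neg]
    exact Int.dvd_of_emod_eq_zero h)
  obtain ⟨d, hd⟩ := Int.eq_ofNat_of_zero_le (Int.emod_nonneg (s - r) hpos.ne')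
  have hlt := Int.emod_lt_of_pos (s - r) hpos
  rw [hd] at h1 hne hlt
  have hd0 : d ≠ 0 := by simpa using hne
  have hdl : d < ℓ ^ n := by exact_mod_cast hlt
  -- The residue `d` can be replaced by `0`, so the other `ℓ^n - 1` residues already cover.
  refine hθ.exists_notMem_cover hℓ ha hx (n := n)
    (D := ((Finset.range (ℓ ^ n)).erase d).image ((↑) : ℕ → ℤ)) ?_ fun z hz => ?_
  · rw [Finset.card_image_of_injective _ Nat.cast_injective,
      Finset.card_erase_of_mem (Finset.mem_range.2 hdl), Finset.card_range]
    omega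
  · obtain ⟨t, ht, hzt⟩ := hθ.exists_inLevel hℓ hz n
    by_cases h : t = d
    · subst h
      refine ⟨0, ?_, InLevel.translate_of_inLevel hℓ hθ h0 h1 hzt⟩
      simp only [Finset.mem_image, Finset.mem_erase, Finset.mem_range]
      exact ⟨0, ⟨hd0.symm, by omega⟩, rfl⟩
    · exact ⟨t, Finset.mem_image_of_mem _ (by simp [h, ht]), hzt⟩

end Recognizability

end Substitution

namespace Substitution

/-! ### The phase map onto the odometer. -/

section Odometer

variable {ℓ : ℕ} [NeZero ℓ] {A : Type u}

theorem nonempty_shiftSpace [Finite A] [Nonempty A] (hℓ : 2 ≤ ℓ) (θ : Substitution ℓ A) :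
    θ.shiftSpace.Nonempty := by
  let _ : TopologicalSpace A := ⊥
  have _ : DiscreteTopology A := ⟨rfl⟩
  obtain ⟨a⟩ := ‹Nonempty A›
  let t : ℕ → Set (ℤ → A) := fun N =>
    (fun (x : ℤ → A) (j : Fin (2 * N + 1)) => x (-(N : ℤ) + (j : ℕ))) ⁻¹'
      {f | θ.Allowed (List.ofFn f)}
  have ht : ∀ N x, x ∈ t N ↔ θ.Allowed (window x (-(N : ℤ)) (2 * N + 1)) := fun _ _ => Iff.rfl
  have hcl : ∀ N, IsClosed (t N) := fun N => (isClosed_discrete _).preimage (by fun_prop)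
  obtain ⟨x, hx⟩ := IsCompact.nonempty_iInter_of_sequence_nonempty_isCompact_isClosed t
    (fun N x hx => by
      rw [ht] at hx ⊢
      exact hx.of_infix (window_infix_window (by push_cast; omega) (by push_cast; omega)))
    (fun N => by
      refine ⟨translate N (θ.onSeq^[2 * N + 1] fun _ => a), ?_⟩
      rw [ht, window_translate, neg_add_cancel]
      refine ⟨2 * N + 1, a, ?_⟩
      have h := θ.onWord_iterate_singleton (fun _ => a) 0 (2 * N + 1)
      rw [mul_zero] at h
      rw [h]
      refine window_infix_window le_rfl ?_
      have : 2 * N + 1 < ℓ ^ (2 * N + 1) := Nat.lt_pow_self hℓ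
      gcongr)
    (hcl 0).isCompact hcl
  refine ⟨x, fun i n => ?_⟩
  have h := (ht _ _).1 (Set.mem_iInter.1 hx (i.natAbs + n))
  exact h.of_infix (window_infix_window (by omega) (by omega))

/-- `π x` records the phases of `x` with respect to all powers of `θ`. -/
def IsPhaseMap (θ : Substitution ℓ A) (π : θ.X → ZAdic ℓ) : Prop :=
  ∀ (x : θ.X) (n : ℕ) (r : ℤ), (π x).1 n = (r : ZMod (ℓ ^ n)) ↔ θ.InLevel n r x.1

theorem Primitive.exists_isPhaseMap [Finite A] {θ : Substitution ℓ A} (hℓ : 2 ≤ ℓ)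
    (hθ : θ.Primitive) (ha : θ.Aperiodic) : ∃ π, θ.IsPhaseMap π := by
  let _ : TopologicalSpace A := ⊥
  have _ : DiscreteTopology A := ⟨rfl⟩
  have h : ∀ (x : θ.X) (n : ℕ), ∃ r : ℤ, θ.InLevel n r x.1 := fun x n => by
    obtain ⟨r, -, hr⟩ := hθ.exists_inLevel hℓ x.2 n
    exact ⟨r, hr⟩
  choose ρ hρ using h
  refine ⟨fun x => ⟨fun n => (ρ x n : ZMod (ℓ ^ n)), fun n => ?_⟩, fun x n r => ?_⟩
  · rw [map_intCast, ZMod.intCast_eq_intCast_iff_dvd_sub]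
    push_cast
    exact InLevel.dvd_sub hℓ hθ ha (hρ x n) ((hρ x (n + 1)).mono n.le_succ)
  · change ((ρ x n : ℤ) : ZMod (ℓ ^ n)) = r ↔ _
    rw [ZMod.intCast_eq_intCast_iff_dvd_sub]
    push_cast
    refine ⟨fun h => (hρ x n).of_dvd ?_, fun h => InLevel.dvd_sub hℓ hθ ha h (hρ x n)⟩
    rwa [dvd_sub_comm]

namespace IsPhaseMap

variable {θ : Substitution ℓ A} {π : θ.X → ZAdic ℓ}

theorem exists_inLevel (h : θ.IsPhaseMap π) (x : θ.X) (n : ℕ) :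
    ∃ r : ℤ, (π x).1 n = r ∧ θ.InLevel n r x.1 := by
  obtain ⟨r, hr⟩ := ZMod.intCast_surjective ((π x).1 n)
  exact ⟨r, hr.symm, (h x n r).1 hr.symm⟩

theorem translate (h : θ.IsPhaseMap π) (x y : θ.X) (m : ℤ)
    (hy : y.1 = Substitution.translate m x.1) : π y = m + π x := by
  refine Subtype.ext (funext fun n => ?_)
  obtain ⟨r, hr, hx⟩ := h.exists_inLevel x n
  have e : (π y).1 n = ((m + r : ℤ) : ZMod (ℓ ^ n)) := by
    rw [h, hy]
    exact hx.translate m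
  rw [e]
  push_cast
  rw [← hr]
  simp

/-- Substituting `k` times sends phase `r` at level `n` to phase `ℓ^k r` at level `n + k`, so it is
multiplication by `ℓ^k`. -/
theorem onSeq_iterate (h : θ.IsPhaseMap π) (x y : θ.X) (k : ℕ)
    (hy : y.1 = θ.onSeq^[k] x.1) : π y = (ℓ : ZAdic ℓ) ^ k * π x := by
  refine Subtype.ext (funext fun n => ?_)
  obtain ⟨r, hr, hx⟩ := h.exists_inLevel x n
  have hk : θ.InLevel (n + k) ((ℓ : ℤ) ^ k * r) y.1 := by
    rw [hy]
    clear hy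
    induction k with
    | zero => simpa using hx
    | succ k ih =>
      rw [Function.iterate_succ_apply', pow_succ', mul_assoc, ← add_assoc]
      exact ih.onSeq
  have e := (h y n _).2 (hk.mono (Nat.le_add_right n k))
  rw [e]
  push_cast
  rw [← hr]
  simp

variable [TopologicalSpace A] [DiscreteTopology A] [Finite A]

theorem continuous (h : θ.IsPhaseMap π) : Continuous π := by
  refine Continuous.subtype_mk (f := fun x => (π x).1) (continuous_pi fun n => ?_) _
  refine continuous_iff_isClosed.2 fun s _ => ?_
  have _ : NeZero (ℓ ^ n) := inferInstance
  have : (fun x => (π x).1 n) ⁻¹' s = ⋃ c ∈ s, (fun x => (π x).1 n) ⁻¹' {c} := by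
    ext x; simp
  rw [this]
  refine s.toFinite.isClosed_biUnion fun c _ => ?_
  obtain ⟨r, rfl⟩ := ZMod.intCast_surjective c
  have e : (fun x => (π x).1 n) ⁻¹' {(r : ZMod (ℓ ^ n))} =
      Subtype.val ⁻¹' {x | θ.InLevel n r x} := by
    ext x
    exact h x n r
  rw [e]
  exact (θ.isClosed_inLevel n r).preimage continuous_subtype_val

theorem surjective [Nonempty A] (hℓ : 2 ≤ ℓ) (h : θ.IsPhaseMap π) :
    Function.Surjective π := fun z => by
  choose r hr using fun n => ZMod.intCast_surjective (z.1 n)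
  let t : ℕ → Set (ℤ → A) := fun n => {x | x ∈ θ.shiftSpace ∧ θ.InLevel n (r n) x}
  have hcl : ∀ n, IsClosed (t n) := fun n =>
    θ.isClosed_shiftSpace.inter (θ.isClosed_inLevel n _)
  obtain ⟨x, hx⟩ := IsCompact.nonempty_iInter_of_sequence_nonempty_isCompact_isClosed t
    (fun n x hx => by
      refine ⟨hx.1, (hx.2.mono n.le_succ).of_dvd ?_⟩
      have e := z.2 n
      rw [← hr n, ← hr (n + 1), map_intCast, eq_comm, ZMod.intCast_eq_intCast_iff_dvd_sub] at e
      exact_mod_cast e)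
    (fun n => by
      obtain ⟨x, hx⟩ := nonempty_shiftSpace hℓ θ
      obtain ⟨s, -, hs⟩ := h.exists_inLevel ⟨x, hx⟩ n
      refine ⟨Substitution.translate (r n - s) x, translate_mem hx _, ?_⟩
      simpa using hs.translate (r n - s))
    (hcl 0).isCompact hcl
  rw [Set.mem_iInter] at hx
  refine ⟨⟨x, (hx 0).1⟩, Subtype.ext (funext fun n => ?_)⟩
  rw [← hr n, h]
  exact (hx n).2

theorem isOdometerFactorMap [Nonempty A] (hℓ : 2 ≤ ℓ) (h : θ.IsPhaseMap π) :
    IsOdometerFactorMap ℓ θ π where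
  continuous := h.continuous
  surjective := h.surjective hℓ
  shift x := by
    rw [h.translate x (θ.shift x) 1 rfl, Int.cast_one, add_comm]

end IsPhaseMap

end Odometer

/-! ### Points in the image of all powers of `θ` are periodic. -/

section Periodic

variable {ℓ : ℕ} [NeZero ℓ] {A : Type u}

theorem exists_iterate_idempotent [Finite A] (f : A → A) :
    ∃ N : ℕ, 0 < N ∧ ∀ k : ℕ, f^[(k + 1) * N] = f^[N] := by
  obtain ⟨i, j, hij, h⟩ := Finite.exists_ne_map_eq_of_infinite fun n : ℕ => f^[n]
  wlog hlt : i < j generalizing i j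
  · exact this j i hij.symm h.symm (by omega)
  obtain ⟨p, rfl⟩ := Nat.exists_eq_add_of_lt hlt
  have hp : ∀ m c, f^[i + m + c * (p + 1)] = f^[i + m] := fun m c => by
    induction c with
    | zero => simp
    | succ c ih =>
      rw [show i + m + (c + 1) * (p + 1) = c * (p + 1) + m + (i + p + 1) by ring,
        Function.iterate_add, ← h, ← Function.iterate_add, ← ih]
      congr 1
      ring
  -- A multiple of the eventual period `p + 1` that is at least the preperiod `i`.
  refine ⟨(i + 1) * (p + 1), by positivity, fun k => ?_⟩
  have e : (i + 1) * (p + 1) = i + (i * p + p + 1) := by ring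
  have := hp (i * p + p + 1) (k * (i + 1))
  rw [← e] at this
  rw [← this]
  congr 1
  ring

theorem onSeq_iterate_eqOn (θ : Substitution ℓ A) {x y : ℤ → A} {M : ℤ}
    (h : ∀ i, -M ≤ i → i < M → x i = y i) (n : ℕ) (i : ℤ) (h1 : -((ℓ : ℤ) ^ n * M) ≤ i)
    (h2 : i < (ℓ : ℤ) ^ n * M) : θ.onSeq^[n] x i = θ.onSeq^[n] y i := by
  have hpos := length_pos ℓ n
  refine θ.onSeq_iterate_congr n (h _ ?_ ?_)
  · rw [Int.le_ediv_iff_mul_le hpos]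
    linarith
  · rw [Int.ediv_lt_iff_lt_mul hpos]
    linarith

/-- A bi-infinite sequence in the image of all powers of `θ` is `θ`-periodic. -/
theorem exists_onSeq_iterate_eq_self [Finite A] (hℓ : 2 ≤ ℓ) (θ : Substitution ℓ A)
    {x : ℤ → A} (h : ∀ n, ∃ y, θ.onSeq^[n] y = x) : ∃ n, 0 < n ∧ θ.onSeq^[n] x = x := by
  let T : A × A → A × A := fun p =>
    (θ ⟨ℓ - 1, by omega⟩ p.1, θ ⟨0, by omega⟩ p.2)
  have hT : ∀ y : ℤ → A, (θ.onSeq y (-1), θ.onSeq y 0) = T (y (-1), y 0) := fun y => by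
    refine Prod.ext ?_ ?_
    · have e := θ.onSeq_apply y (-1) ⟨ℓ - 1, by omega⟩
      rw [show (ℓ : ℤ) * (-1) + (ℓ - 1 : ℕ) = -1 by omega] at e
      exact e
    · have e := θ.onSeq_apply y 0 ⟨0, by omega⟩
      rw [mul_zero, Nat.cast_zero, add_zero] at e
      exact e
  have hTn : ∀ (n : ℕ) (y : ℤ → A),
      (θ.onSeq^[n] y (-1), θ.onSeq^[n] y 0) = T^[n] (y (-1), y 0) := fun n y => by
    induction n with
    | zero => rfl
    | succ n ih => rw [Function.iterate_succ_apply', Function.iterate_succ_apply', hT, ih]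
  obtain ⟨N, hN, hTN⟩ := exists_iterate_idempotent T
  -- Write `x = θ^{kN}(θ^N y)`. The letters at `-1` and `0` of `x` and of `θ^N y` agree because
  -- `T^[(k+1)N] = T^[N]`, and this seed determines the image under `θ^{kN}` on the whole interval.
  have hfix : ∀ (k : ℕ) (i : ℤ), -((ℓ : ℤ) ^ (k * N) * 1) ≤ i → i < (ℓ : ℤ) ^ (k * N) * 1 →
      θ.onSeq^[k * N] x i = x i := fun k i h1 h2 => by
    obtain ⟨y, hy⟩ := h ((k + 1) * N)
    have hy' : θ.onSeq^[k * N] (θ.onSeq^[N] y) = x := by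
      rw [← Function.iterate_add_apply, ← hy]
      congr 2
      ring
    have e : (x (-1), x 0) = (θ.onSeq^[N] y (-1), θ.onSeq^[N] y 0) := by
      conv_lhs => rw [← hy]
      rw [hTn, hTn, hTN]
    rw [Prod.mk.injEq] at e
    conv_rhs => rw [← hy']
    refine θ.onSeq_iterate_eqOn (fun j hj1 hj2 => ?_) _ i h1 h2
    obtain rfl | rfl : j = -1 ∨ j = 0 := by omega
    · exact e.1
    · exact e.2
  refine ⟨N, hN, funext fun i => ?_⟩
  have hbig : (i.natAbs : ℤ) < (ℓ : ℤ) ^ (i.natAbs * N) := by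
    have h1 : i.natAbs < ℓ ^ i.natAbs := Nat.lt_pow_self hℓ
    have h2 : ℓ ^ i.natAbs ≤ ℓ ^ (i.natAbs * N) :=
      Nat.pow_le_pow_right (by omega) (Nat.le_mul_of_pos_right _ hN)
    exact_mod_cast h1.trans_le h2
  set k := i.natAbs
  have hmono : (ℓ : ℤ) ^ (k * N) ≤ (ℓ : ℤ) ^ ((k + 1) * N) :=
    pow_le_pow_right₀ (by omega) (by gcongr; omega)
  have hmono' : (ℓ : ℤ) ^ (k * N) ≤ (ℓ : ℤ) ^ N * ((ℓ : ℤ) ^ (k * N) * 1) :=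
    (mul_one ((ℓ : ℤ) ^ (k * N))).symm.le.trans
      (le_mul_of_one_le_left (by positivity) (length_pos ℓ N))
  have e1 := θ.onSeq_iterate_eqOn (hfix k) N i (by omega) (by omega)
  have e2 := hfix (k + 1) i (by omega) (by omega)
  rw [← e1, ← Function.iterate_add_apply, ← e2, add_mul, one_mul, add_comm N]

end Periodic

end Substitution

/-- `1 - ℓ^n` is a unit of `ℤ_ℓ`. -/
theorem ZAdic.eq_zero_of_eq_pow_mul {ℓ n : ℕ} (hn : 0 < n) {w : ZAdic ℓ}
    (h : w = (ℓ : ZAdic ℓ) ^ n * w) : w = 0 := by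
  obtain ⟨d, rfl⟩ := Nat.exists_eq_add_of_lt hn
  have hc : IsCoprime (1 - (ℓ : ℤ) ^ (0 + d + 1)) (ℓ : ℤ) :=
    ⟨1, (ℓ : ℤ) ^ d, by ring⟩
  have hu := ZAdic.isUnit_intCast hc
  refine hu.mul_right_eq_zero.1 ?_
  push_cast
  rw [sub_mul, one_mul, ← h, sub_self]

namespace Substitution

/-! ### Existence and uniqueness of normalised factor maps. -/

section Normalised

variable {ℓ : ℕ} [NeZero ℓ] {A : Type u} {θ : Substitution ℓ A}

theorem IsPhaseMap.isNormalisedFactorMap [TopologicalSpace A] [DiscreteTopology A] [Finite A]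
    [Nonempty A] (hℓ : 2 ≤ ℓ) {π : θ.X → ZAdic ℓ} (h : θ.IsPhaseMap π) :
    IsNormalisedFactorMap ℓ θ π where
  toIsOdometerFactorMap := h.isOdometerFactorMap hℓ
  eq_zero_iff x := by
    constructor
    · intro hx
      refine θ.exists_onSeq_iterate_eq_self hℓ fun n => ?_
      have h0 : θ.InLevel n 0 x.1 := (h x n 0).1 (by rw [hx]; simp)
      obtain ⟨y, -, hy⟩ := h0
      exact ⟨y, by rw [hy, translate_zero]⟩
    · rintro ⟨n, hn, hx⟩
      exact ZAdic.eq_zero_of_eq_pow_mul hn (h.onSeq_iterate x x n hx.symm)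

/-- Two continuous equivariant maps to the odometer differ by a constant. -/
theorem Primitive.sub_eq_const [TopologicalSpace A] (hℓ : 2 ≤ ℓ) (hθ : θ.Primitive)
    {π π' : θ.X → ZAdic ℓ} (hc : Continuous π) (hc' : Continuous π')
    (hs : ∀ x, π (θ.shift x) = π x + 1) (hs' : ∀ x, π' (θ.shift x) = π' x + 1) (x y : θ.X) :
    π x - π' x = π y - π' y := by
  have hcl : IsClosed {v : θ.X | π v - π' v = π x - π' x} :=
    isClosed_eq (hc.sub hc') continuous_const
  obtain ⟨C, hC, he⟩ := isClosed_induced_iff.1 hcl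
  have h1 : ∀ n : ℕ, θ.shift^[n] x ∈ {v : θ.X | π v - π' v = π x - π' x} := fun n => by
    induction n with
    | zero => simp
    | succ n ih =>
      rw [Function.iterate_succ_apply', Set.mem_ofPred_eq, hs, hs', add_sub_add_right_eq_sub]
      exact ih
  have h2 : y.1 ∈ C := hθ.mem_of_forall_translate_mem hℓ x.2 y.2 hC fun n => by
    have := h1 n
    rw [← he] at this
    rw [← shift_iterate_val]
    exact this
  have h3 : y ∈ {v : θ.X | π v - π' v = π x - π' x} := by
    rw [← he]; exact h2
  exact h3.symm

/-- The maps differ by a constant, which vanishes at any periodic point. -/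
theorem Primitive.eq_of_isNormalisedFactorMap [TopologicalSpace A] (hℓ : 2 ≤ ℓ)
    (hθ : θ.Primitive) {π π' : θ.X → ZAdic ℓ} (h : IsNormalisedFactorMap ℓ θ π)
    (h' : IsNormalisedFactorMap ℓ θ π') : π = π' := by
  funext x
  obtain ⟨y, hy⟩ := h.surjective 0
  have e := hθ.sub_eq_const hℓ h.continuous h'.continuous h.shift h'.shift x y
  rw [hy, (h'.eq_zero_iff y).2 ((h.eq_zero_iff y).1 hy), sub_self] at e
  exact sub_eq_zero.1 e

end Normalised

/-! ### Powers of `θ` generate the same shift space. -/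

section Powers

variable {ℓ L : ℕ} [NeZero ℓ] [NeZero L] {A : Type u} {θ : Substitution ℓ A}
  {η : Substitution L A} {n : ℕ}

theorem onWord_iterate_of_onSeq_eq (hL : L = ℓ ^ n) (hη : η.onSeq = θ.onSeq^[n]) (N : ℕ)
    (a : A) : η.onWord^[N] [a] = θ.onWord^[n * N] [a] := by
  have h1 := η.onWord_iterate_singleton (fun _ => a) 0 N
  have h2 := θ.onWord_iterate_singleton (fun _ => a) 0 (n * N)
  rw [mul_zero] at h1 h2
  rw [h1, h2, hη, hL, ← pow_mul, ← Function.iterate_mul]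

/-- `η` sees only exponents divisible by `n`; primitivity puts an allowed word in all large powers,
hence in one of these. -/
theorem Primitive.allowed_iff_of_onSeq_eq (hθ : θ.Primitive) (hn : 0 < n) (hL : L = ℓ ^ n)
    (hη : η.onSeq = θ.onSeq^[n]) (w : List A) : η.Allowed w ↔ θ.Allowed w := by
  constructor
  · rintro ⟨N, a, h⟩
    rw [onWord_iterate_of_onSeq_eq hL hη] at h
    exact ⟨_, a, h⟩
  · intro h
    obtain ⟨N, hN⟩ := hθ.exists_infix h
    obtain ⟨-, a, -⟩ := h
    refine ⟨N, a, ?_⟩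
    rw [onWord_iterate_of_onSeq_eq hL hη]
    exact hN _ (Nat.le_mul_of_pos_left N hn) a

theorem Primitive.shiftSpace_eq_of_onSeq_eq (hθ : θ.Primitive) (hn : 0 < n) (hL : L = ℓ ^ n)
    (hη : η.onSeq = θ.onSeq^[n]) : η.shiftSpace = θ.shiftSpace := by
  ext x
  simp only [mem_shiftSpace_iff, hθ.allowed_iff_of_onSeq_eq hn hL hη]

theorem onSeq_power (θ : Substitution ℓ A) (n : ℕ) : (θ.power n).onSeq = θ.onSeq^[n] := by
  have hn : ∀ (n : ℕ) (x : ℤ → A) (i : ℤ) (m : Fin (ℓ ^ n)),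
      θ.onSeq^[n] x ((ℓ ^ n : ℕ) * i + (m : ℕ)) = θ.power n m (x i) := by
    intro n
    induction n with
    | zero =>
      intro x i m
      have : (m : ℕ) = 0 := by have := m.2; simp at this; omega
      simp [power, this]
    | succ n ih =>
      intro x i m
      have hd : (m : ℕ) / ℓ < ℓ ^ n := Nat.div_lt_of_lt_mul (by rw [mul_comm]; exact m.2)
      have hr : (m : ℕ) % ℓ < ℓ := Nat.mod_lt _ (Nat.pos_of_ne_zero (NeZero.ne ℓ))
      have e : ((ℓ ^ (n + 1) : ℕ) * i + (m : ℕ) : ℤ) =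
          ℓ * ((ℓ ^ n : ℕ) * i + ((⟨(m : ℕ) / ℓ, hd⟩ : Fin (ℓ ^ n)) : ℕ)) +
            ((⟨(m : ℕ) % ℓ, hr⟩ : Fin ℓ) : ℕ) := by
        have := Nat.div_add_mod (m : ℕ) ℓ
        conv_lhs => rw [← this]
        push_cast
        ring
      rw [Function.iterate_succ_apply', e, onSeq_apply, ih]
      rfl
  funext x i
  have hpos := length_pos ℓ n
  have h0 := Int.emod_nonneg i hpos.ne'
  obtain ⟨m, hm⟩ := Int.eq_ofNat_of_zero_le h0
  have hlt : m < ℓ ^ n := by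
    have := Int.emod_lt_of_pos i hpos
    rw [hm] at this
    exact_mod_cast this
  have e : i = (ℓ ^ n : ℕ) * (i / (ℓ : ℤ) ^ n) + ((⟨m, hlt⟩ : Fin (ℓ ^ n)) : ℕ) := by
    have := Int.mul_ediv_add_emod i ((ℓ : ℤ) ^ n)
    rw [hm] at this
    push_cast
    exact this.symm
  rw [e, hn, onSeq_apply]

end Powers

/-! ### Two-letter coding intertwines `σ^k ∘ η` with the shifted extension. -/

section ShiftedExtension

variable {L : ℕ} {A : Type u} {η : Substitution L A}

/-- The sequence of two-letter words of a point of `X_η`. -/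
def pairing (x : η.X) : ℤ → η.TwoWords := fun i =>
  ⟨(x.1 i, x.1 (i + 1)), by
    have := mem_shiftSpace_iff.1 x.2 i 2
    rwa [window_two] at this⟩

theorem pairing_eq_of_eq {x y : η.X} {i j : ℤ} (h0 : x.1 i = y.1 j)
    (h1 : x.1 (i + 1) = y.1 (j + 1)) : pairing x i = pairing y j :=
  Subtype.ext (Prod.ext h0 h1)

variable [NeZero L]

theorem onSeq_pairing (k : Fin L) (x y : η.X) (hy : y.1 = translate (k : ℕ) (η.onSeq x.1)) :
    (η.shiftedExt k).onSeq (pairing x) = pairing y := by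
  funext i
  have hpos := length_pos L 1
  rw [pow_one] at hpos
  obtain ⟨m, hm⟩ := Int.eq_ofNat_of_zero_le (Int.emod_nonneg i hpos.ne')
  have hlt : m < L := by
    have := Int.emod_lt_of_pos i hpos
    rw [hm] at this
    exact_mod_cast this
  obtain ⟨j, rfl⟩ : ∃ j : ℤ, i = L * j + ((⟨m, hlt⟩ : Fin L) : ℕ) := ⟨i / L, by
    have := Int.mul_ediv_add_emod i L
    rw [hm] at this
    exact this.symm⟩
  rw [onSeq_apply]
  have hw := η.onWord_window x.1 j 2
  rw [window_two] at hw
  have hg : ∀ (t : ℕ) (ht : t < (η.onWord [x.1 j, x.1 (j + 1)]).length),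
      (η.onWord [x.1 j, x.1 (j + 1)])[t] = η.onSeq x.1 (L * j + t) := fun t ht => by
    rw [List.getElem_of_eq hw, getElem_window]
  refine Subtype.ext (Prod.ext ?_ ?_)
  · refine (hg _ _).trans ?_
    change _ = y.1 _
    rw [hy, translate]
    congr 1
    push_cast
    ring
  · refine (hg _ _).trans ?_
    change _ = y.1 _
    rw [hy, translate]
    congr 1
    push_cast
    ring

/-- Since `η ∘ σ = σ^L ∘ η`, the iterate `(σ^k ∘ η)^N` collects the geometric sum as its shift. -/
theorem onSeq_iterate_pairing (k : Fin L) (N : ℕ) (x y : η.X)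
    (hy : y.1 = translate (k * ∑ i ∈ Finset.range N, (L : ℤ) ^ i) (η.onSeq^[N] x.1)) :
    (η.shiftedExt k).onSeq^[N] (pairing x) = pairing y := by
  induction N generalizing y with
  | zero =>
    obtain rfl : y = x := Subtype.ext (by simpa using hy)
    rfl
  | succ N ih =>
    rw [Function.iterate_succ_apply', ih ⟨_, translate_mem (onSeq_iterate_mem x.2 N) _⟩ rfl]
    refine onSeq_pairing k _ _ ?_
    rw [hy, onSeq_translate, translate_translate, Function.iterate_succ_apply', geom_sum_succ]
    congr 1
    ring

end ShiftedExtension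

end Substitution

namespace Substitution

/-! ### The shift space of the extension, the conjugacy and its `κ`-value. -/

section Conjugacy

variable {ℓ L : ℕ} [NeZero ℓ] [NeZero L] {A : Type u} {θ : Substitution ℓ A}
  {η : Substitution L A} {n : ℕ}

theorem Primitive.pairing_mem (hℓ : 2 ≤ ℓ) (hL2 : 2 ≤ L) (hθ : θ.Primitive)
    (hX : η.shiftSpace = θ.shiftSpace) (k : Fin L) (x : η.X) :
    pairing x ∈ (η.shiftedExt k).shiftSpace := by
  refine mem_shiftSpace_iff.2 fun i m => ?_
  have hx : x.1 ∈ θ.shiftSpace := hX ▸ x.2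
  obtain ⟨R, hR⟩ := hθ.exists_infix_window hℓ (mem_shiftSpace_iff.1 hx i (m + 1))
  let y : η.X := ⟨_, translate_mem (onSeq_iterate_mem x.2 R)
    (k * ∑ i ∈ Finset.range R, (L : ℤ) ^ i)⟩
  have hy := onSeq_iterate_pairing k R x y rfl
  refine ⟨R, pairing x 0, ?_⟩
  rw [onWord_iterate_singleton, hy, infix_window_iff]
  obtain ⟨j, hj, h⟩ := infix_window_iff.1 (hR y.1 (hX ▸ y.2) ((L : ℤ) ^ R * 0))
  rw [length_window] at hj h
  -- The recurrence bound `R` doubles as the exponent: a block of length `L^R` is long enough to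
  -- contain the word.
  have hRL : R < L ^ R := Nat.lt_pow_self hL2
  refine ⟨j, by rw [length_window]; omega, ?_⟩
  rw [length_window, window_eq_iff]
  rw [window_eq_iff] at h
  intro t ht
  refine pairing_eq_of_eq (h t (by omega)) ?_
  have := h (t + 1) (by omega)
  push_cast at this
  rwa [← add_assoc, ← add_assoc] at this

/-- A letter of the extension is an allowed pair, so it occurs in some coded point; iterating the
extension there yields another coded point. -/
theorem Primitive.exists_window_pairing [Finite A] [Nonempty A] (hℓ : 2 ≤ ℓ)
    (hθ : θ.Primitive) (hA : ∀ w, η.Allowed w ↔ θ.Allowed w)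
    (hX : η.shiftSpace = θ.shiftSpace) {k : Fin L} {u : ℤ → η.TwoWords}
    (hu : u ∈ (η.shiftedExt k).shiftSpace) (i : ℤ) (m : ℕ) :
    ∃ (x : η.X) (j : ℤ), ∀ t : ℕ, t < m → u (i + t) = pairing x (j + t) := by
  obtain ⟨N, w, hN⟩ := mem_shiftSpace_iff.1 hu i m
  obtain ⟨x, hx⟩ := nonempty_shiftSpace hℓ θ
  obtain ⟨R, hR⟩ := hθ.exists_infix_window hℓ ((hA _).1 w.2)
  obtain ⟨j, -, hj⟩ := infix_window_iff.1 (hR x hx 0)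
  have hj2 : [w.1.1, w.1.2] = window x (0 + j) 2 := hj
  rw [window_two] at hj2
  let v : η.X := ⟨x, hX ▸ hx⟩
  have hw : w = pairing v (0 + j) := by
    simp only [List.cons.injEq, and_true] at hj2
    exact Subtype.ext (Prod.ext hj2.1 hj2.2)
  let y : η.X := ⟨_, translate_mem (onSeq_iterate_mem v.2 N)
    (k * ∑ i ∈ Finset.range N, (L : ℤ) ^ i)⟩
  rw [hw, onWord_iterate_singleton, onSeq_iterate_pairing k N v y rfl, infix_window_iff] at hN
  obtain ⟨s, -, hs⟩ := hN
  rw [length_window, window_eq_iff] at hs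
  exact ⟨y, _, hs⟩

theorem Primitive.exists_pairing_eq [Finite A] [Nonempty A] (hℓ : 2 ≤ ℓ)
    (hθ : θ.Primitive) (hA : ∀ w, η.Allowed w ↔ θ.Allowed w)
    (hX : η.shiftSpace = θ.shiftSpace) {k : Fin L} {u : ℤ → η.TwoWords}
    (hu : u ∈ (η.shiftedExt k).shiftSpace) :
    ∃ x : η.X, (x.1 = fun i => (u i).1.1) ∧ pairing x = u := by
  have key := hθ.exists_window_pairing hℓ hA hX hu
  have hmem : (fun i => (u i).1.1) ∈ η.shiftSpace := mem_shiftSpace_iff.2 fun i m => by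
    obtain ⟨x, j, h⟩ := key i m
    have : window (fun i => (u i).1.1) i m = window x.1 j m :=
      window_eq_iff.2 fun t ht => by rw [h t ht]; rfl
    rw [this]
    exact x.2 j m
  refine ⟨⟨_, hmem⟩, rfl, funext fun i => Subtype.ext (Prod.ext rfl ?_)⟩
  obtain ⟨x, j, h⟩ := key i 2
  have h0 := h 0 (by omega)
  have h1 := h 1 (by omega)
  simp only [Nat.cast_zero, add_zero, Nat.cast_one] at h0 h1
  change (u (i + 1)).1.1 = (u i).1.2
  rw [h0, h1]
  rfl

/-- The extension by `k` of a power of `θ` is conjugate to `θ`, by a code with `κ`-value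
`m + k / (1 - L)`. -/
theorem Primitive.exists_conjugacy_shiftedExt [Finite A] [Nonempty A] [TopologicalSpace A]
    [DiscreteTopology A] (hℓ : 2 ≤ ℓ) (hθ : θ.Primitive) (ha : θ.Aperiodic) (hn : 0 < n)
    (hL : L = ℓ ^ n) (hη : η.onSeq = θ.onSeq^[n]) (k : Fin L) (m : ℤ) (z : ZAdic ℓ)
    (hz : (1 - (L : ZAdic ℓ)) * (z - m) = ((k : ℕ) : ZAdic ℓ)) :
    ∃ F : (η.shiftedExt k).X → θ.X, IsConjugacy (η.shiftedExt k) θ F ∧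
      (∀ (x : (η.shiftedExt k).X) (i : ℤ), (F x).1 i = (x.1 (i + m)).1.1) ∧
      HasKappaValue ℓ (η.shiftedExt k) θ F z ∧
      (TrivialHeight ℓ θ → TrivialHeight ℓ (η.shiftedExt k)) := by
  have hL2 : 2 ≤ L := by
    rw [hL]
    exact hℓ.trans (Nat.le_self_pow hn.ne' ℓ)
  have hA := hθ.allowed_iff_of_onSeq_eq hn hL hη
  have hX := hθ.shiftSpace_eq_of_onSeq_eq hn hL hη
  have key := fun u : (η.shiftedExt k).X => hθ.exists_pairing_eq hℓ hA hX u.2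
  have hG : ∀ x : θ.X, translate (-m) x.1 ∈ η.shiftSpace := fun x =>
    by
    rw [hX]; exact translate_mem x.2 _
  have hF : ∀ u : (η.shiftedExt k).X, (fun i => (u.1 (i + m)).1.1) ∈ θ.shiftSpace := fun u => by
    obtain ⟨x, hx, -⟩ := key u
    have := translate_mem x.2 m
    rw [hx, hX] at this
    exact this
  let F : (η.shiftedExt k).X → θ.X := fun u => ⟨_, hF u⟩
  let G : θ.X → (η.shiftedExt k).X := fun x =>
    ⟨pairing ⟨_, hG x⟩, hθ.pairing_mem hℓ hL2 hX k _⟩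
  have hFG : ∀ x, F (G x) = x := fun x => Subtype.ext (funext fun i => by
    change x.1 (i + m + -m) = x.1 i
    rw [add_neg_cancel_right])
  have hGF : ∀ u, G (F u) = u := fun u => by
    obtain ⟨x, hx, hxu⟩ := key u
    refine Subtype.ext (Eq.trans ?_ hxu)
    refine congrArg pairing (Subtype.ext ?_)
    rw [hx]
    funext i
    change (u.1 (i + -m + m)).1.1 = _
    rw [neg_add_cancel_right]
  have hFc : Continuous F := by
    exact Continuous.subtype_mk (continuous_pi fun i => continuous_fst.comp
      (continuous_subtype_val.comp ((continuous_apply (i + m)).comp continuous_subtype_val))) _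
  have hGc : Continuous G := by
    refine Continuous.subtype_mk (continuous_pi fun i => ?_) _
    exact Continuous.subtype_mk
      (((continuous_apply (i + -m)).comp continuous_subtype_val).prodMk
        ((continuous_apply (i + 1 + -m)).comp continuous_subtype_val)) _
  have hFs : ∀ u, F ((η.shiftedExt k).shift u) = θ.shift (F u) := fun u =>
    Subtype.ext (funext fun i => by
      change (u.1 (i + m + 1)).1.1 = (u.1 (i + 1 + m)).1.1
      rw [add_right_comm])
  have hGs : ∀ x, G (θ.shift x) = (η.shiftedExt k).shift (G x) := fun x => by
    rw [← hGF ((η.shiftedExt k).shift (G x)), hFs, hFG]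
  obtain ⟨π, hπ⟩ := hθ.exists_isPhaseMap hℓ ha
  have hπo := hπ.isOdometerFactorMap hℓ
  have hπn := hπ.isNormalisedFactorMap hℓ
  have hζo : ∀ c : ZAdic ℓ, IsOdometerFactorMap ℓ (η.shiftedExt k) fun u => π (F u) - c :=
    fun c => {
      continuous := (hπo.continuous.comp hFc).sub continuous_const
      surjective := fun w => by
        obtain ⟨x, hx⟩ := hπo.surjective (w + c)
        exact ⟨G x, by simp only [hFG, hx, add_sub_cancel_right]⟩
      shift := fun u => by
        rw [hFs, hπo.shift]
        ring }
  have hζn : IsNormalisedFactorMap ℓ (η.shiftedExt k) fun u => π (F u) - z := {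
    toIsOdometerFactorMap := hζo z
    eq_zero_iff := fun u => by
      obtain ⟨x, hx, hxu⟩ := key u
      let x' : θ.X := ⟨x.1, hX ▸ x.2⟩
      have hFu : π (F u) = m + π x' := hπ.translate x' (F u) m (by
        change _ = translate m x.1
        rw [hx]
        rfl)
      -- The accumulated shift equals `(1 - L^N)(z - m)`: it is congruent to `z - m` modulo
      -- `ℓ^{nN}`, which yields preimages of every order, and it makes `z - m` the only possible
      -- phase of a periodic point.
      have hS : ∀ N : ℕ, ((k * ∑ i ∈ Finset.range N, (L : ℤ) ^ i : ℤ) : ZAdic ℓ) =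
          (1 - (ℓ : ZAdic ℓ) ^ (n * N)) * (z - m) := fun N => by
        have h1 := geom_sum_mul_neg (L : ZAdic ℓ) N
        have h2 : (L : ZAdic ℓ) = (ℓ : ZAdic ℓ) ^ n := by rw [hL]; push_cast; rfl
        push_cast
        rw [pow_mul, ← h2, ← h1, ← hz]
        ring
      constructor
      · intro h0
        refine exists_onSeq_iterate_eq_self hL2 _ fun N => ?_
        have hx0 : π x' = z - m := by linear_combination h0 - hFu
        obtain ⟨y, hy, hxy⟩ := (hπ x' (n * N) (k * ∑ i ∈ Finset.range N, (L : ℤ) ^ i)).1 (by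
          have h1 := congrArg (fun w : ZAdic ℓ => w.1 (n * N)) (hS N)
          have h2 : (ℓ : ZMod (ℓ ^ (n * N))) ^ (n * N) = 0 := by
            exact_mod_cast ZMod.natCast_self (ℓ ^ (n * N))
          rw [hx0]
          simpa [h2] using h1.symm)
        refine ⟨pairing ⟨y, hX ▸ hy⟩, ?_⟩
        rw [← hxu]
        refine onSeq_iterate_pairing k N _ x ?_
        rw [hη, ← Function.iterate_mul]
        exact hxy
      · rintro ⟨N, hN, hu⟩
        let y : η.X := ⟨_, translate_mem (onSeq_iterate_mem x.2 N)
          (k * ∑ i ∈ Finset.range N, (L : ℤ) ^ i)⟩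
        have hyx : y.1 = x.1 := by
          have e : pairing y = pairing x := by
            rw [← onSeq_iterate_pairing k N x y rfl, hxu]
            exact hu
          funext i
          exact congrArg (fun v : ℤ → η.TwoWords => (v i).1.1) e
        let v : θ.X := ⟨_, onSeq_iterate_mem x'.2 (n * N)⟩
        have h1 := hπ.onSeq_iterate x' v (n * N) rfl
        have h2 := hπ.translate v x' (k * ∑ i ∈ Finset.range N, (L : ℤ) ^ i) (by
          change x.1 = translate _ (θ.onSeq^[n * N] x.1)
          rw [Function.iterate_mul, ← hη]
          exact hyx.symm)
        refine ZAdic.eq_zero_of_eq_pow_mul (n := n * N) (by positivity) ?_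
        rw [h1, hS] at h2
        rw [hFu]
        linear_combination h2 }
  refine ⟨F, ⟨hFc, ⟨Function.LeftInverse.injective hGF, Function.RightInverse.surjective hFG⟩,
    hFs⟩, fun _ _ => rfl, ⟨⟨_, hζn⟩, ⟨_, hπn⟩, fun π₁ π₂ h₁ h₂ u => ?_⟩, ?_⟩
  · obtain rfl := hθ.eq_of_isNormalisedFactorMap hℓ hπn h₂
    -- A zero of `π₁` is `ζ`-periodic, hence also a zero of `π ∘ F - z`; this fixes the constant
    -- difference as `z`.
    obtain ⟨v, hv⟩ := h₁.surjective 0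
    have e := hθ.sub_eq_const hℓ (π' := fun x => π₁ (G x)) hπn.continuous
      (h₁.continuous.comp hGc) hπn.shift (fun x => by rw [hGs, h₁.shift]) (F u) (F v)
    simp only [hGF] at e
    have hv' := (hζn.eq_zero_iff v).2 ((h₁.eq_zero_iff v).1 hv)
    change π (F v) - z = 0 at hv'
    rw [hv, sub_zero, sub_eq_zero.1 hv'] at e
    rw [← e, sub_add_cancel]
  · rintro ⟨ρ, hρ, hmax⟩
    refine ⟨fun u => ρ (F u), ⟨hρ.continuous.comp hFc, fun w => ?_, fun u => by
      rw [hFs, hρ.shift]⟩, fun Z _ _ T g hT hg hgs hgT => ?_⟩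
    · obtain ⟨x, hx⟩ := hρ.surjective w
      exact ⟨G x, by simp only [hFG, hx]⟩
    · obtain ⟨h, hh, e⟩ := hmax Z T (fun x => g (G x)) hT (hg.comp hGc)
        (fun w => by
          obtain ⟨u, hu⟩ := hgs w
          exact ⟨F u, by simp only [hGF, hu]⟩)
        (fun x => by rw [hGs, hgT])
      exact ⟨h, hh, fun u => by rw [← e, hGF]⟩

end Conjugacy

end Substitution

/-! ### Rationals in `ℤ_ℓ` and the final assembly. -/

theorem ZAdic.isCoprime_of_mul_eq {ℓ q : ℕ} {p : ℤ} (hpq : IsCoprime p (q : ℤ)) {z : ZAdic ℓ}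
    (hz : (q : ZAdic ℓ) * z = (p : ZAdic ℓ)) : q.Coprime ℓ := by
  obtain ⟨a, b, hab⟩ := hpq
  have h1 := congrArg (fun w : ZAdic ℓ => w.1 1) hz
  have h2 : (q : ZMod (ℓ ^ 1)) * z.1 1 = (p : ZMod (ℓ ^ 1)) := by simpa using h1
  have h3 := congrArg (Int.cast : ℤ → ZMod (ℓ ^ 1)) hab
  push_cast at h3
  -- Substituting `p = q z` into the Bézout identity `a p + b q = 1` exhibits the inverse `a z + b`
  -- modulo `ℓ`.
  have hu : IsUnit (q : ZMod (ℓ ^ 1)) :=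
    IsUnit.of_mul_eq_one (a * z.1 1 + b) (by linear_combination h3 + a * h2)
  rw [ZMod.isUnit_iff_coprime, pow_one] at hu
  exact hu

/-- A rational in `ℤ_ℓ` with denominator `q` has the form `m + k / (1 - ℓ^{φ(q)})`. -/
theorem ZAdic.exists_eq_add_of_mul_eq {ℓ q : ℕ} (hℓ : 2 ≤ ℓ) (hq : 0 < q) {p : ℤ}
    (hpq : IsCoprime p (q : ℤ)) {z : ZAdic ℓ} (hz : (q : ZAdic ℓ) * z = (p : ZAdic ℓ)) :
    ∃ (k : Fin (ℓ ^ Nat.totient q)) (m : ℤ),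
      (1 - ((ℓ ^ Nat.totient q : ℕ) : ZAdic ℓ)) * (z - m) = ((k : ℕ) : ZAdic ℓ) := by
  have hmod := Nat.ModEq.pow_totient (ZAdic.isCoprime_of_mul_eq hpq hz).symm
  have hL : 2 ≤ ℓ ^ Nat.totient q := hℓ.trans (Nat.le_self_pow (Nat.totient_pos.2 hq).ne' ℓ)
  -- From `L - 1 = q c` one gets `(1 - L) z = -c p`, an integer. Dividing it by `L - 1` gives
  -- quotient `e` and remainder `r`, whence `m = -e` and `k = r`.
  obtain ⟨c, hc⟩ := hmod.symm.dvd
  generalize ℓ ^ Nat.totient q = L at *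
  have hpos : (0 : ℤ) < L - 1 := by omega
  obtain ⟨r, hr⟩ := Int.eq_ofNat_of_zero_le (Int.emod_nonneg (-c * p) hpos.ne')
  have hlt := Int.emod_lt_of_pos (-c * p) hpos
  have hdiv := Int.mul_ediv_add_emod (-c * p) (L - 1)
  rw [hr] at hlt hdiv
  generalize -c * p / ((L : ℤ) - 1) = e at hdiv
  refine ⟨⟨r, by omega⟩, -e, ?_⟩
  have h1 := congrArg (Int.cast : ℤ → ZAdic ℓ) hdiv
  have h2 := congrArg (Int.cast : ℤ → ZAdic ℓ) hc
  push_cast at h1 h2 ⊢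
  linear_combination -h1 - z * h2 - c * hz

theorem mainTheorem10 {A : Type u} [Finite A] [Nonempty A] [TopologicalSpace A]
    [DiscreteTopology A] {ℓ : ℕ} [NeZero ℓ] (hℓ : 2 ≤ ℓ) (θ : Substitution ℓ A)
    (hprim : θ.Primitive) (haper : θ.Aperiodic) :
    (∀ k : Fin ℓ, ∃ F : (θ.shiftedExt k).X → θ.X,
      Substitution.IsConjugacy (θ.shiftedExt k) θ F ∧
      (∀ (x : (θ.shiftedExt k).X) (n : ℤ), (F x).1 n = (x.1 n).1.1) ∧
      (∃ z : ZAdic ℓ, (1 - (ℓ : ZAdic ℓ)) * z = ((k : ℕ) : ZAdic ℓ) ∧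
        Substitution.HasKappaValue ℓ (θ.shiftedExt k) θ F z) ∧
      (Substitution.TrivialHeight ℓ θ → Substitution.TrivialHeight ℓ (θ.shiftedExt k))) ∧
    (∀ (p : ℤ) (q : ℕ), 0 < q → IsCoprime p (q : ℤ) →
      ∀ z : ZAdic ℓ, (q : ZAdic ℓ) * z = (p : ZAdic ℓ) →
      ∃ (k : Fin (ℓ ^ Nat.totient q))
        (F : ((θ.power (Nat.totient q)).shiftedExt k).X → θ.X),
        Substitution.IsConjugacy ((θ.power (Nat.totient q)).shiftedExt k) θ F ∧
        Substitution.HasKappaValue ℓ ((θ.power (Nat.totient q)).shiftedExt k) θ F z ∧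
        (Substitution.TrivialHeight ℓ θ →
          Substitution.TrivialHeight ℓ ((θ.power (Nat.totient q)).shiftedExt k))) := by
  refine ⟨fun k => ?_, fun p q hq hpq z hz => ?_⟩
  · obtain ⟨w, hw⟩ := (ZAdic.isUnit_one_sub ℓ).exists_right_inv
    have hz : (1 - (ℓ : ZAdic ℓ)) * (w * ((k : ℕ) : ZAdic ℓ)) = ((k : ℕ) : ZAdic ℓ) := by
      rw [← mul_assoc, hw, one_mul]
    obtain ⟨F, hF, hc, hκ, hT⟩ := hprim.exists_conjugacy_shiftedExt (η := θ) (n := 1) hℓ haper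
      one_pos (pow_one ℓ).symm rfl k 0 _ (by rw [Int.cast_zero, sub_zero]; exact hz)
    exact ⟨F, hF, fun x i => by rw [hc, add_zero], ⟨_, hz, hκ⟩, hT⟩
  · obtain ⟨k, m, hk⟩ := ZAdic.exists_eq_add_of_mul_eq hℓ hq hpq hz
    obtain ⟨F, hF, -, hκ, hT⟩ := hprim.exists_conjugacy_shiftedExt hℓ haper
      (Nat.totient_pos.2 hq) rfl (θ.onSeq_power _) k m z hk
    exact ⟨k, F, hF, hκ, hT⟩
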